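/- **Setting.** Let $N\ge 1$, $a,b,\delta\in\mathbb C$, and for $r=1,\dots,N$ let $(p_r,P_r)\in\mathbb C^2$ with $P_r^2=(p_r^2-a^2)(p_r^2-b^2)$, $P_r\neq0$. Let $e_r$ be the unit vectors of $\mathbb Z^N$ and write $u_r(n)=u(n+e_r)$, $u_{rs}(n)=u(n+e_r+e_s)$. Let $u,\mathscr U:\mathbb Z^N\to\mathbb C$, $\mathscr U$ nowhere zero, satisfy for all $r,s$ the lattice equation ${\rm Q3}_\delta$ and the factorisation $$P_r(uu_s+u_ru_{rs})-P_s(uu_r+u_su_{rs})-(p_r^2-p_s^2)\Big(u_ru_s+uu_{rs}+\tfrac{\delta^2}{4P_rP_s}\Big)=0,$$ $$\mathscr U\,\mathscr U_r=P_r(u^2+u_r^2)-(2p_r^2-a^2-b^2)uu_r+\tfrac{\delta^2}{4P_r}.$$ Put $V_{r,s}(n)=\big(P_su_{rs}-(p_s^2-p_r^2)u_r-P_ru\big)/\mathscr U_r$, evaluated at $n$. Let $\Gamma=(x_i)_{i\in\mathbb Z}$ be a staircase, $x_{i+1}=x_i+e_{r_i}$, with set of directions ${\rm I}=\{r_i\}$;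 assume $p_r\ne0$ for $r\in{\rm I}$. The potential is $\upsilon_{i+1}=V_{r_i,r_{i+1}}(x_i)-p_{r_i}-p_{r_{i+1}}$. Let $K$ be a real number larger than $\big|\frac{p_r\pm a}{p_r\mp a}\big|$ and $\big|\frac{p_r\pm b}{p_r\mp b}\big|$ for all $r\in{\rm I}$, and put $$\mathscr P=\bigcup_{r\in{\rm I}}\Big\{\zeta:\Big|\tfrac{p_r-\zeta}{p_r+\zeta}\Big|>K\Big\},\qquad \mathscr P^*=\bigcup_{r\in{\rm I}}\Big\{\zeta:\Big|\tfrac{p_r+\zeta}{p_r-\zeta}\Big|>K\Big\},\qquad \rho(n;\zeta)=\prod_{r=1}^N\Big(\tfrac{p_r+\zeta}{p_r-\zeta}\Big)^{n_r}.$$ **Jost functions.** Let $E$ be a finite set of points (specified below). The $N$-dimensional Jost functions $\Lambda(n;\zeta)$, $\Upsilon(n;\zeta)$ are defined by the following conditions. For all $n,r,s$ and $\zeta\notin\mathscr P\cup E$, $$(p_s+\zeta)\Lambda(n+e_r+e_s)-V_{r,s}(n)\Lambda(n+e_r)+(p_r-\zeta)\Lambda(n)=0,$$ and $\Upsilon(\cdot\,;\zeta)$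 satisfies the same equation with $\zeta$ replaced by $-\zeta$ in the coefficients; along $\Gamma$ (that is, $n=x_i$, $r=r_i$, $s=r_{i+1}$) these hold for all $\zeta\notin\mathscr P$. For every $m\in\mathbb Z^N$ and $\zeta\notin\mathscr P\cup E$, $\Lambda(x_i+m;\zeta)\to1$ as $i\to-\infty$ and $\Upsilon(x_i+m;\zeta)\to1$ as $i\to+\infty$. On $\Gamma$ itself, for every $\zeta\notin\mathscr P$, $\Lambda(x_i;\zeta)=1+o(K^{-|i|})$ as $i\to-\infty$ and $\Upsilon(x_i;\zeta)=1+o(K^{-|i|})$ as $i\to+\infty$. For each $n$, $\Lambda(n;\cdot)$ and $\Upsilon(n;\cdot)$ are continuous off $\mathscr P\cup E$. The spectral functions $\mathtt A,\mathtt B$ are the coefficients in $\Upsilon(n;\zeta)=\mathtt A(\zeta)\Lambda(n;-\zeta)+\mathtt B(\zeta)\rho(n;\zeta)\Lambda(n;\zeta)$ for $n\in\Gamma$, given by the Wronskian formulas (independent of $i$) $$\mathtt A(\zeta)=\tfrac1{2\zeta}\big[(p_{r_i}+\zeta)\Upsilon(x_i;\zeta)\Lambda(x_{i+1};\zeta)-(p_{r_i}-\zeta)\Upsilon(x_{i+1};\zeta)\Lambda(x_i;\zeta)\big],$$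 $$\mathtt B(\zeta)=\tfrac{p_{r_i}-\zeta}{2\zeta}\,\rho(x_i;\zeta)^{-1}\big[\Lambda(x_i;-\zeta)\Upsilon(x_{i+1};\zeta)-\Lambda(x_{i+1};-\zeta)\Upsilon(x_i;\zeta)\big].$$ Assume that the potential is admissible: $\sum_{i\in\mathbb Z}|\upsilon_i|K^{|i|}(1+|i|)<\infty$, and the zeros $\zeta_1,\dots,\zeta_M$ of $\mathtt A$ in $\mathbb C\setminus(\overline{\mathscr P}\cup\{0\})$ are finite in number and simple. **Contour.** Let $L\subset\mathbb C\setminus\overline{\mathscr P}$ be a positively oriented simple closed piecewise $C^1$ curve with bounded interior region $\mathcal R^+$ and unbounded exterior region $\mathcal R^-$, such that $\mathscr P^*\subseteq\mathcal R^+$, all $\zeta_j\in\mathcal R^+$, and $0,\pm a,\pm b\in\mathcal R^-$. Assume moreover that $-z\in\mathcal R^-$ for all $z\in\mathcal R^+\cup L$, that no $\pm p_r$ lies on $L$, and that $\zeta_j\ne\pm p_r$ for all $j,r$. Take $E=\{-p_r: 1\le r\le N,\ p_r\in\mathcal R^+\}$. **Proposition.** There are constants $c_j$, for the $j$ with $\zeta_j\in\mathscr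 P^*$, such that $\Upsilon(x_i;\zeta_j)=c_j\,\rho(x_i;\zeta_j)\,\Lambda(x_i;\zeta_j)$ for all $i$, and with $$C_j=\frac{c_j}{\mathtt A'(\zeta_j)}\ \text{ if }\zeta_j\in\mathscr P^*,\qquad C_j=\frac{\mathtt B(\zeta_j)}{\mathtt A'(\zeta_j)}\ \text{ if }\zeta_j\notin\mathscr P^*,\qquad R=\frac{\mathtt B}{\mathtt A},$$ the following holds for every $n\in\mathbb Z^N$. The function $R\,\Lambda(n;\cdot)\,\rho(n;\cdot)$ is integrable on $L$ and, for all $\zeta$ with $-\zeta\in\mathcal R^-$, $$\Lambda(n;\zeta)=1-\sum_{j=1}^M\frac{C_j\Lambda(n;\zeta_j)}{\zeta+\zeta_j}\,\rho(n;\zeta_j)+\frac1{2\pi i}\int_L\frac{R(\sigma)\Lambda(n;\sigma)}{\sigma+\zeta}\,\rho(n;\sigma)\,d\sigma .$$ Moreover this solution is unique: any function $f$ with $Rf\rho(n;\cdot)$ integrable on $L$ that satisfies this equation (with $f$ in place of $\Lambda(n;\cdot)$) for all $\zeta$ with $-\zeta\in\mathcal R^-$ equals $\Lambda(n;\cdot)$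 there. (The set $\{\zeta:-\zeta\in\mathcal R^-\}$ contains $L$ and all $\zeta_j$.) -/

import Mathlib

open Set Filter Topology

/-- A solution of the lattice equation `Q3_δ` on every elementary quadrilateral of `ℤ^N`.
The direction `r` carries the parameter `(p r, P r)`, a point of the elliptic curve
`X² = (x² - a²)(x² - b²)` with `P r ≠ 0`. The function `U` is the factor of the biquadratic,
`U Ũ = H_{p_r}(u, ũ)`, on every edge. -/
structure Q3Solution (N : ℕ) where
  a : ℂ
  b : ℂ
  δ : ℂ
  p : Fin N → ℂ
  P : Fin N → ℂ
  curve : ∀ r, P r ^ 2 = (p r ^ 2 - a ^ 2) * (p r ^ 2 - b ^ 2)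
  P_ne : ∀ r, P r ≠ 0
  u : (Fin N → ℤ) → ℂ
  U : (Fin N → ℤ) → ℂ
  U_ne : ∀ n, U n ≠ 0
  /-- the equation `Q3_δ` in the plane of the directions `r` (shift `ũ`) and `s` (shift `û`) -/
  q3 : ∀ n r s,
    P r * (u n * u (n + Pi.single s 1)
        + u (n + Pi.single r 1) * u (n + Pi.single r 1 + Pi.single s 1))
      - P s * (u n * u (n + Pi.single r 1)
        + u (n + Pi.single s 1) * u (n + Pi.single r 1 + Pi.single s 1))
      - (p r ^ 2 - p s ^ 2) * (u (n + Pi.single r 1) * u (n + Pi.single s 1)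
        + u n * u (n + Pi.single r 1 + Pi.single s 1) + δ ^ 2 / (4 * P r * P s)) = 0
  /-- the factorisation of the biquadratic on each edge -/
  factor : ∀ n r, U n * U (n + Pi.single r 1)
    = P r * (u n ^ 2 + u (n + Pi.single r 1) ^ 2)
      - (2 * p r ^ 2 - a ^ 2 - b ^ 2) * u n * u (n + Pi.single r 1) + δ ^ 2 / (4 * P r)

/-- A staircase in `ℤ^N`: a bi-infinite lattice path whose `i`-th step is a unit step in the
direction `dir i`. -/
structure Staircase (N : ℕ) where
  dir : ℤ → Fin N
  pt : ℤ → Fin N → ℤ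
  step : ∀ i, pt (i + 1) = pt i + Pi.single (dir i) 1

/-- The plane-wave factor `ρ(ζ) = ∏_r ((p_r + ζ)/(p_r - ζ))^{n_r}` at the lattice point `n`. -/
noncomputable def planeWave {N : ℕ} (p : Fin N → ℂ) (n : Fin N → ℤ) (ζ : ℂ) : ℂ :=
  ∏ r, ((p r + ζ) / (p r - ζ)) ^ n r

namespace Q3Solution

variable {N : ℕ} (S : Q3Solution N)

/-- The coefficient of the middle term in the scalar second-order equation for a step in the
direction `r` followed by a step in the direction `s`, starting at `n`. -/
noncomputable def coeff (n : Fin N → ℤ) (r s : Fin N) : ℂ :=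
  (S.P s * S.u (n + Pi.single r 1 + Pi.single s 1)
    - (S.p s ^ 2 - S.p r ^ 2) * S.u (n + Pi.single r 1) - S.P r * S.u n)
    / S.U (n + Pi.single r 1)

variable (Γ : Staircase N)

/-- The potential `υ_i` on the staircase. -/
noncomputable def potential (i : ℤ) : ℂ :=
  S.coeff (Γ.pt (i - 1)) (Γ.dir (i - 1)) (Γ.dir i) - S.p (Γ.dir (i - 1)) - S.p (Γ.dir i)

/-- The constant `K` exceeds the moduli of `((p_r ± a)/(p_r ∓ a))` and `((p_r ± b)/(p_r ∓ b))`
for all directions `r` of the staircase. -/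
def WeightBound (K : ℝ) : Prop :=
  ∀ i, ∀ c ∈ ({S.a, -S.a, S.b, -S.b} : Set ℂ),
    ‖(S.p (Γ.dir i) + c) / (S.p (Γ.dir i) - c)‖ < K

/-- The open region `𝒫`, the union over the directions of the staircase of the sets
`|(p_r - ζ)/(p_r + ζ)| > K` (cleared of denominators, so that `-p_r ∈ 𝒫`). -/
def regionP (K : ℝ) : Set ℂ :=
  {ζ | ∃ i, K * ‖S.p (Γ.dir i) + ζ‖ < ‖S.p (Γ.dir i) - ζ‖}

/-- The open region `𝒫*`, the union over the directions of the staircase of the sets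
`|(p_r + ζ)/(p_r - ζ)| > K`. -/
def regionPStar (K : ℝ) : Set ℂ :=
  {ζ | ∃ i, K * ‖S.p (Γ.dir i) - ζ‖ < ‖S.p (Γ.dir i) + ζ‖}

/-- `Λ` and `Υ` are the N-dimensional Jost functions with respect to the staircase `Γ`:
`φ = Λ ρ^{1/2}` and `ψ = Υ ρ^{-1/2}` solve the scalar linear problem
`(p_s² - ζ²)^{1/2} φ(n + e_r + e_s) - coeff φ(n + e_r) + (p_r² - ζ²)^{1/2} φ(n) = 0`
for all pairs of directions, and are asymptotic to the pure plane waves `ρ^{1/2}` as `i → -∞`,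
respectively `ρ^{-1/2}` as `i → +∞`, along `Γ` and along all its translates. The equations are
written for `Λ` and `Υ`, which removes the square roots.

On `Γ` the error in the boundary condition is `o(K^{-|i|})`. Where the other plane wave is
recessive the bare condition `Λ → 1` does not fix the solution; this form of it does, for
every `ζ ∉ 𝒫`.

`E` is a set of spectral parameters at which the functions may be undefined off `Γ`. -/
structure IsJost (K : ℝ) (E : Set ℂ) (Lam Ups : (Fin N → ℤ) → ℂ → ℂ) : Prop where
  lam_stair : ∀ i : ℤ, ∀ ζ ∉ S.regionP Γ K,
    (S.p (Γ.dir (i + 1)) + ζ) * Lam (Γ.pt (i + 2)) ζ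
      - (S.p (Γ.dir i) + S.p (Γ.dir (i + 1)) + S.potential Γ (i + 1)) * Lam (Γ.pt (i + 1)) ζ
      + (S.p (Γ.dir i) - ζ) * Lam (Γ.pt i) ζ = 0
  ups_stair : ∀ i : ℤ, ∀ ζ ∉ S.regionP Γ K,
    (S.p (Γ.dir (i + 1)) - ζ) * Ups (Γ.pt (i + 2)) ζ
      - (S.p (Γ.dir i) + S.p (Γ.dir (i + 1)) + S.potential Γ (i + 1)) * Ups (Γ.pt (i + 1)) ζ
      + (S.p (Γ.dir i) + ζ) * Ups (Γ.pt i) ζ = 0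
  lam_bdry : ∀ ζ ∉ S.regionP Γ K,
    Tendsto (fun i : ℤ => (Lam (Γ.pt i) ζ - 1) * (K : ℂ) ^ i.natAbs) atBot (𝓝 0)
  ups_bdry : ∀ ζ ∉ S.regionP Γ K,
    Tendsto (fun i : ℤ => (Ups (Γ.pt i) ζ - 1) * (K : ℂ) ^ i.natAbs) atTop (𝓝 0)
  lam_lattice : ∀ n r s, ∀ ζ ∉ S.regionP Γ K ∪ E,
    (S.p s + ζ) * Lam (n + Pi.single r 1 + Pi.single s 1) ζ
      - S.coeff n r s * Lam (n + Pi.single r 1) ζ + (S.p r - ζ) * Lam n ζ = 0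
  ups_lattice : ∀ n r s, ∀ ζ ∉ S.regionP Γ K ∪ E,
    (S.p s - ζ) * Ups (n + Pi.single r 1 + Pi.single s 1) ζ
      - S.coeff n r s * Ups (n + Pi.single r 1) ζ + (S.p r + ζ) * Ups n ζ = 0
  lam_translate : ∀ m, ∀ ζ ∉ S.regionP Γ K ∪ E,
    Tendsto (fun i : ℤ => Lam (Γ.pt i + m) ζ) atBot (𝓝 1)
  ups_translate : ∀ m, ∀ ζ ∉ S.regionP Γ K ∪ E,
    Tendsto (fun i : ℤ => Ups (Γ.pt i + m) ζ) atTop (𝓝 1)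
  lam_cont : ∀ n, ContinuousOn (Lam n) (S.regionP Γ K ∪ E)ᶜ
  ups_cont : ∀ n, ContinuousOn (Ups n) (S.regionP Γ K ∪ E)ᶜ

variable (Lam Ups : (Fin N → ℤ) → ℂ → ℂ)

/-- The spectral function `A`, the coefficient of `φ(·; -ζ)` in `ψ = A φ(·; -ζ) + B φ`, by
Cramer's rule: `A = W(ψ, φ) / (2ζ)`. The Wronskian does not depend on `i`; it is taken
at `i = 0`. -/
noncomputable def specA (ζ : ℂ) : ℂ :=
  ((S.p (Γ.dir 0) + ζ) * Ups (Γ.pt 0) ζ * Lam (Γ.pt 1) ζ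
    - (S.p (Γ.dir 0) - ζ) * Ups (Γ.pt 1) ζ * Lam (Γ.pt 0) ζ) / (2 * ζ)

/-- The spectral function `B`, the coefficient of `φ` in `ψ = A φ(·; -ζ) + B φ`, by Cramer's
rule: `B = W(φ(·; -ζ), ψ) / (2ζ)`, at `i = 0`. The plane wave is taken at the point of the
staircase, which makes `B` the coefficient in `Υ(ζ) = A(ζ) Λ(-ζ) + B(ζ) ρ(ζ) Λ(ζ)`. -/
noncomputable def specB (ζ : ℂ) : ℂ :=
  (S.p (Γ.dir 0) - ζ) / (2 * ζ) * (planeWave S.p (Γ.pt 0) ζ)⁻¹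
    * (Lam (Γ.pt 0) (-ζ) * Ups (Γ.pt 1) ζ - Lam (Γ.pt 1) (-ζ) * Ups (Γ.pt 0) ζ)

/-- The zeros of `A` outside the closure of `𝒫`. The point `0`, where the formula for `A` is
singular, is not counted. -/
def zerosA (K : ℝ) : Set ℂ :=
  {ζ | ζ ≠ 0 ∧ ζ ∉ closure (S.regionP Γ K) ∧ S.specA Γ Lam Ups ζ = 0}

/-- The potential is admissible: the weighted summability condition holds, and `A` has finitely
many zeros outside the closure of `𝒫`, all simple. -/
structure Admissible (K : ℝ) : Prop where
  summable : Summable fun i : ℤ =>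
    ‖S.potential Γ i‖ * K ^ i.natAbs * (1 + (i.natAbs : ℝ))
  finite_zeros : (S.zerosA Γ Lam Ups K).Finite
  simple_zeros : ∀ z ∈ S.zerosA Γ Lam Ups K, deriv (S.specA Γ Lam Ups) z ≠ 0

open Classical in
/-- The constants `C_j` attached to the zeros `ζ_j` of `A`, where `c` gives the constants `c_j`
at the zeros in `𝒫*`. -/
noncomputable def normC (K : ℝ) (c : ℂ → ℂ) (z : ℂ) : ℂ :=
  if z ∈ S.regionPStar Γ K then c z / deriv (S.specA Γ Lam Ups) z
  else S.specB Γ Lam Ups z / deriv (S.specA Γ Lam Ups) z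

end Q3Solution

/-- A simple closed piecewise continuously differentiable curve, parametrised on `[0, 1]`. -/
structure ClosedContour where
  path : ℝ → ℂ
  cont : ContinuousOn path (Icc 0 1)
  closed : path 0 = path 1
  simple : InjOn path (Ico 0 1)
  piecewise : ∃ T : Finset ℝ,
    (∀ t ∈ Ioo (0 : ℝ) 1 \ (T : Set ℝ), DifferentiableAt ℝ path t) ∧
    ContinuousOn (deriv path) (Ioo (0 : ℝ) 1 \ (T : Set ℝ)) ∧
    ∃ M : ℝ, ∀ t ∈ Ioo (0 : ℝ) 1 \ (T : Set ℝ), ‖deriv path t‖ ≤ M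

namespace ClosedContour

variable (L : ClosedContour)

/-- The curve as a set of points. -/
def trace : Set ℂ := L.path '' Icc 0 1

/-- The interior region `ℛ⁺`: the points in bounded components of the complement. -/
def inside : Set ℂ :=
  {z | z ∉ L.trace ∧ Bornology.IsBounded (connectedComponentIn L.traceᶜ z)}

/-- The exterior region `ℛ⁻`: the points in unbounded components of the complement. -/
def outside : Set ℂ :=
  {z | z ∉ L.trace ∧ ¬ Bornology.IsBounded (connectedComponentIn L.traceᶜ z)}

/-- The contour integral `∫_L g(σ) dσ`. -/
noncomputable def integral (g : ℂ → ℂ) : ℂ :=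
  ∫ t in (0 : ℝ)..1, g (L.path t) * deriv L.path t

/-- Integrability of `g` along the contour. -/
def Integrable (g : ℂ → ℂ) : Prop :=
  IntervalIntegrable (fun t => g (L.path t) * deriv L.path t) MeasureTheory.volume 0 1

/-- Positive orientation: the contour winds once around each point inside. -/
def PositivelyOriented : Prop :=
  ∀ z ∈ L.inside, L.integral (fun σ => (σ - z)⁻¹) = 2 * Real.pi * Complex.I

end ClosedContour

/-- `f` solves the singular integral equation at the lattice point `n`, for all `ζ` with
`-ζ ∈ ℛ⁻`. -/
def Q3Solution.SolvesIntegralEq {N : ℕ} (S : Q3Solution N) (Γ : Staircase N)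
    (Lam Ups : (Fin N → ℤ) → ℂ → ℂ) (K : ℝ) (L : ClosedContour) (c : ℂ → ℂ)
    (n : Fin N → ℤ) (f : ℂ → ℂ) : Prop :=
  L.Integrable (fun σ =>
    S.specB Γ Lam Ups σ / S.specA Γ Lam Ups σ * f σ * planeWave S.p n σ) ∧
  ∀ ζ : ℂ, -ζ ∈ L.outside →
    f ζ = 1
      - ∑ᶠ z ∈ S.zerosA Γ Lam Ups K,
          S.normC Γ Lam Ups K c z * f z / (ζ + z) * planeWave S.p n z
      + 1 / (2 * Real.pi * Complex.I) * L.integral (fun σ =>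
          S.specB Γ Lam Ups σ / S.specA Γ Lam Ups σ * f σ / (σ + ζ) * planeWave S.p n σ)

/-!
The proof is the classical derivation of the singular integral equation, arranged so that no
boundary regularity beyond continuity is needed: the contour may touch the boundary of `𝒫*`, so
`Λ(n;-σ)` and `R` are merely continuous on it, while the functions holomorphic on the reflected
exterior `W = {z | -z ∈ outside}` are holomorphic near the contour and its interior.

*Holomorphy.* Along the staircase the recurrence is stable in the weight `K ^ (-i)`
(`stairEnergy_le`), so the Jost function is the limit of rational functions with poles inside the
contour. Hence `σ ↦ Λ(n;-σ)` satisfies the Cauchy formula for the exterior domain, with value `1`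
at infinity (`IsExteriorCauchy`). This property survives the division by linear factors which
carries it from the staircase to the lattice; it holds for `Υ` by reversal of the staircase, and it
gives the holomorphy of `Λ` and `Υ` on `W`.

*Existence.* A constant Wronskian and the fact that a lattice solution is determined by two
consecutive points of the staircase give `Υ = A Λ(·;-ζ) + B ρ Λ` on the contour and the
proportionality of `Υ` and `ρ Λ` at the zeros of `A`. In the exterior Cauchy formula of `Λ(n;-σ)`,
the term `Υ / A` is evaluated by the residue theorem inside (`cauchyIntegral_div`), which rests on
Dixon's proof of Cauchy's theorem (`cauchyIntegral_eq_zero`); the rest is the contour integral of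
the equation.

*Uniqueness.* Let `d` be the difference of two solutions, and let `M` be `Λ(n)` or
`(p_r + ζ) Λ(n + e_r)`. Then `d(-z) M(z) - M(-z) d(z)` is odd and continues to an entire function
that vanishes at infinity (`mul_neg_eq_of_cauchyTransform`), so it is zero. Since the Wronskian of
`Λ(·;-z)` and `Λ(·;z)` is `2z`, the two choices of `M` together give `d = 0`.
-/

/-! ### Integrals depending holomorphically on a parameter -/

theorem dslope_comm (f : ℂ → ℂ) (z w : ℂ) : dslope f z w = dslope f w z := by
  rcases eq_or_ne z w with rfl | h
  · rfl
  · rw [dslope_of_ne _ h.symm, dslope_of_ne _ h, slope_comm]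

/-- Integration against an integrable density preserves holomorphy in a parameter, provided the
kernel is locally bounded: Cauchy's estimate turns the bound on the kernel into a bound on its
derivative, so that dominated convergence applies. -/
theorem differentiableOn_integral_mul {φ : ℝ → ℂ}
    (hφ : IntervalIntegrable φ MeasureTheory.volume 0 1) {k : ℂ → ℝ → ℂ} {W : Set ℂ}
    (hcont : ∀ z ∈ W, ContinuousOn (k z) (Icc 0 1))
    (hdiff : ∀ t ∈ Icc (0 : ℝ) 1, DifferentiableOn ℂ (fun z => k z t) W)
    (hbound : ∀ z₀ ∈ W, ∃ r > 0, Metric.ball z₀ r ⊆ W ∧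
      ∃ C, ∀ z ∈ Metric.ball z₀ r, ∀ t ∈ Icc (0 : ℝ) 1, ‖k z t‖ ≤ C) :
    DifferentiableOn ℂ (fun z => ∫ t in (0 : ℝ)..1, φ t * k z t) W := by
  intro z₀ hz₀
  obtain ⟨r, hr, hrW, C, hC⟩ := hbound z₀ hz₀
  have hIoc : uIoc (0 : ℝ) 1 ⊆ Icc 0 1 := by
    rw [uIoc_of_le zero_le_one]; exact Ioc_subset_Icc_self
  have hmφ : MeasureTheory.AEStronglyMeasurable φ
      (MeasureTheory.volume.restrict (uIoc (0 : ℝ) 1)) :=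
    (intervalIntegrable_iff.1 hφ).aestronglyMeasurable
  have hmk : ∀ z ∈ W, MeasureTheory.AEStronglyMeasurable (k z)
      (MeasureTheory.volume.restrict (uIoc (0 : ℝ) 1)) := fun z hz =>
    ((hcont z hz).mono hIoc).aestronglyMeasurable measurableSet_uIoc
  have hmem : ∀ z ∈ Metric.ball z₀ (r / 2), ∀ w ∈ Metric.closedBall z (r / 2),
      w ∈ Metric.ball z₀ r := by
    intro z hz w hw
    rw [Metric.mem_ball] at *
    rw [Metric.mem_closedBall] at hw
    linarith [dist_triangle w z z₀]
  have hder : ∀ t ∈ Icc (0 : ℝ) 1, ∀ z ∈ Metric.ball z₀ r,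
      HasDerivAt (fun z => k z t) (deriv (fun z => k z t) z) z := fun t ht z hz =>
    (((hdiff t ht).mono hrW).differentiableAt (Metric.isOpen_ball.mem_nhds hz)).hasDerivAt
  have hderle : ∀ t ∈ Icc (0 : ℝ) 1, ∀ z ∈ Metric.ball z₀ (r / 2),
      ‖deriv (fun z => k z t) z‖ ≤ C / (r / 2) := by
    intro t ht z hz
    refine Complex.norm_deriv_le_of_forall_mem_sphere_norm_le (half_pos hr) ?_
      fun w hw => hC w (hmem z hz w (Metric.sphere_subset_closedBall hw)) t ht
    refine DifferentiableOn.diffContOnCl ?_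
    exact (hdiff t ht).mono fun w hw =>
      hrW (hmem z hz w (Metric.closure_ball_subset_closedBall hw))
  have hz₀' : z₀ ∈ Metric.ball z₀ (r / 2) := Metric.mem_ball_self (half_pos hr)
  have hsub : Metric.ball z₀ (r / 2) ⊆ Metric.ball z₀ r :=
    Metric.ball_subset_ball (by linarith)
  -- the derivative of the kernel is measurable in `t`, as a limit of difference quotients
  have hmd : MeasureTheory.AEStronglyMeasurable (fun t => deriv (fun z => k z t) z₀)
      (MeasureTheory.volume.restrict (uIoc (0 : ℝ) 1)) := by
    have hseq : Tendsto (fun n : ℕ => ((r / 2 : ℝ) : ℂ) / ((n : ℂ) + 1)) atTop (𝓝[≠] 0) := by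
      refine tendsto_nhdsWithin_iff.2 ⟨?_, ?_⟩
      · have := (tendsto_one_div_add_atTop_nhds_zero_nat (𝕜 := ℂ)).const_mul ((r / 2 : ℝ) : ℂ)
        simpa [div_eq_mul_inv] using this
      · refine Eventually.of_forall fun n => ?_
        have h1 : ((n : ℂ) + 1) ≠ 0 := Nat.cast_add_one_ne_zero n
        have h2 : ((r / 2 : ℝ) : ℂ) ≠ 0 := by exact_mod_cast (half_pos hr).ne'
        exact div_ne_zero h2 h1
    have hW : ∀ᶠ n : ℕ in atTop, z₀ + ((r / 2 : ℝ) : ℂ) / ((n : ℂ) + 1) ∈ W := by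
      have h : Tendsto (fun n : ℕ => z₀ + ((r / 2 : ℝ) : ℂ) / ((n : ℂ) + 1)) atTop (𝓝 z₀) := by
        simpa using (hseq.mono_right nhdsWithin_le_nhds).const_add z₀
      exact h.eventually (mem_of_superset (Metric.ball_mem_nhds z₀ hr) hrW)
    obtain ⟨n₀, hn₀⟩ := eventually_atTop.1 hW
    refine aestronglyMeasurable_of_tendsto_ae (u := atTop)
      (f := fun (n : ℕ) t => (((r / 2 : ℝ) : ℂ) / (((n + n₀ : ℕ) : ℂ) + 1))⁻¹
        * (k (z₀ + ((r / 2 : ℝ) : ℂ) / (((n + n₀ : ℕ) : ℂ) + 1)) t - k z₀ t)) ?_ ?_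
    · intro n
      exact ((hmk _ (hn₀ _ (by omega))).sub (hmk _ hz₀)).const_mul _
    · rw [MeasureTheory.ae_restrict_iff' measurableSet_uIoc]
      refine Eventually.of_forall fun t ht => ?_
      have h := hasDerivAt_iff_tendsto_slope_zero.1 (hder t (hIoc ht) z₀ (hsub hz₀'))
      have h2 := h.comp (hseq.comp (tendsto_add_atTop_nat n₀))
      exact h2
  have key := (intervalIntegral.hasDerivAt_integral_of_dominated_loc_of_deriv_le (𝕜 := ℂ)
    (μ := MeasureTheory.volume) (a := 0) (b := 1) (x₀ := z₀)
    (F := fun z t => φ t * k z t) (F' := fun z t => φ t * deriv (fun z => k z t) z)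
    (bound := fun t => ‖φ t‖ * (C / (r / 2))) (Metric.ball_mem_nhds z₀ (half_pos hr))
    ?_ ?_ ?_ ?_ ?_ ?_).2
  · exact key.differentiableAt.differentiableWithinAt
  · filter_upwards [mem_of_superset (Metric.ball_mem_nhds z₀ hr) hrW] with z hz
    exact hmφ.mul (hmk z hz)
  · exact hφ.mul_continuousOn (by rw [uIcc_of_le zero_le_one]; exact hcont z₀ hz₀)
  · exact hmφ.mul hmd
  · refine Eventually.of_forall fun t ht z hz => ?_
    rw [norm_mul]
    exact mul_le_mul_of_nonneg_left (hderle t (hIoc ht) z hz) (norm_nonneg _)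
  · exact hφ.norm.mul_const _
  · refine Eventually.of_forall fun t ht z hz => ?_
    exact (hder t (hIoc ht) z (hsub hz)).const_mul (φ t)

namespace ClosedContour

variable (L : ClosedContour)

/-! ### The interior and the exterior of a closed contour -/

theorem path_mem_trace {t : ℝ} (ht : t ∈ Icc (0 : ℝ) 1) : L.path t ∈ L.trace :=
  mem_image_of_mem _ ht

theorem isCompact_trace : IsCompact L.trace := isCompact_Icc.image_of_continuousOn L.cont

theorem isOpen_compl_trace : IsOpen L.traceᶜ := L.isCompact_trace.isClosed.isOpen_compl

theorem trace_bound : ∃ R > 0, ∀ z ∈ L.trace, ‖z‖ ≤ R := by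
  obtain ⟨R, hR⟩ := L.isCompact_trace.isBounded.exists_norm_le
  exact ⟨max R 1, lt_max_of_lt_right one_pos, fun z hz => (hR z hz).trans (le_max_left _ _)⟩

theorem isPreconnected_norm_gt (R : ℝ) (hR : 0 < R) : IsPreconnected {z : ℂ | R < ‖z‖} := by
  have h : {z : ℂ | R < ‖z‖} = Complex.exp '' {z : ℂ | Real.log R < z.re} := by
    ext z
    simp only [mem_ofPred_eq, mem_image]
    constructor
    · intro hz
      have hz0 : z ≠ 0 := by
        rintro rfl
        rw [norm_zero] at hz
        linarith
      refine ⟨Complex.log z, ?_, Complex.exp_log hz0⟩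
      rw [Complex.log_re]
      exact Real.log_lt_log hR hz
    · rintro ⟨w, hw, rfl⟩
      rw [Complex.norm_exp]
      calc R = Real.exp (Real.log R) := (Real.exp_log hR).symm
        _ < _ := Real.exp_lt_exp.2 hw
  rw [h]
  exact ((convex_halfSpace_re_gt _).isPreconnected).image _ Complex.continuous_exp.continuousOn

variable {L}

theorem mem_component_of_norm_gt {R : ℝ} (hR : 0 < R) (hRb : ∀ z ∈ L.trace, ‖z‖ ≤ R) {z w : ℂ}
    (hz : R < ‖z‖) (hw : R < ‖w‖) : w ∈ connectedComponentIn L.traceᶜ z :=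
  (isPreconnected_norm_gt R hR).subset_connectedComponentIn (F := L.traceᶜ) hz
    (fun x hx hxt => absurd (hRb x hxt) (not_le.2 hx)) hw

theorem mem_outside_of_norm_gt {R : ℝ} (hR : 0 < R) (hRb : ∀ z ∈ L.trace, ‖z‖ ≤ R) {z : ℂ}
    (hz : R < ‖z‖) : z ∈ L.outside := by
  refine ⟨fun h => absurd (hRb z h) (not_le.2 hz), fun hb => ?_⟩
  obtain ⟨C, hC⟩ := hb.exists_norm_le
  have h := hC (((max C R + 1 : ℝ)) : ℂ) (mem_component_of_norm_gt hR hRb hz (by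
    rw [Complex.norm_real, Real.norm_eq_abs]
    exact lt_of_lt_of_le (by linarith [le_max_right C R]) (le_abs_self _)))
  rw [Complex.norm_real, Real.norm_eq_abs] at h
  linarith [le_abs_self (max C R + 1), le_max_left C R]

/-- An unbounded component contains every point of large modulus. -/
theorem mem_component_of_mem_outside {R : ℝ} (hR : 0 < R) (hRb : ∀ z ∈ L.trace, ‖z‖ ≤ R) {z w : ℂ}
    (hz : z ∈ L.outside) (hw : R < ‖w‖) : w ∈ connectedComponentIn L.traceᶜ z := by
  have h : ∃ x ∈ connectedComponentIn L.traceᶜ z, R < ‖x‖ := by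
    by_contra! hcon
    exact hz.2 ((Metric.isBounded_closedBall (x := (0 : ℂ)) (r := R)).subset fun x hx => by
      simpa using hcon x hx)
  obtain ⟨x, hx, hxR⟩ := h
  rw [connectedComponentIn_eq hx]
  exact mem_component_of_norm_gt hR hRb hxR hw

theorem isOpen_outside : IsOpen L.outside := by
  rw [isOpen_iff_mem_nhds]
  intro z hz
  filter_upwards [L.isOpen_compl_trace.connectedComponentIn.mem_nhds
    (mem_connectedComponentIn (F := L.traceᶜ) hz.1)] with w hw
  exact ⟨connectedComponentIn_subset _ _ hw, by rw [← connectedComponentIn_eq hw]; exact hz.2⟩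

theorem isOpen_inside : IsOpen L.inside := by
  rw [isOpen_iff_mem_nhds]
  intro z hz
  filter_upwards [L.isOpen_compl_trace.connectedComponentIn.mem_nhds
    (mem_connectedComponentIn (F := L.traceᶜ) hz.1)] with w hw
  exact ⟨connectedComponentIn_subset _ _ hw, by rw [← connectedComponentIn_eq hw]; exact hz.2⟩

theorem isPreconnected_outside : IsPreconnected L.outside := by
  obtain ⟨R, hR, hRb⟩ := L.trace_bound
  have hw : R < ‖((R + 1 : ℝ) : ℂ)‖ := by
    rw [Complex.norm_real, Real.norm_eq_abs]
    exact lt_of_lt_of_le (by linarith) (le_abs_self _)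
  have h : L.outside = connectedComponentIn L.traceᶜ ((R + 1 : ℝ) : ℂ) := by
    ext z
    constructor
    · intro hz
      rw [← connectedComponentIn_eq (mem_component_of_mem_outside hR hRb hz hw)]
      exact mem_connectedComponentIn hz.1
    · intro hz
      have h2 := mem_outside_of_norm_gt hR hRb hw
      refine ⟨connectedComponentIn_subset _ _ hz, ?_⟩
      rw [← connectedComponentIn_eq hz]
      exact h2.2
  rw [h]
  exact isPreconnected_connectedComponentIn

theorem eventually_mem_outside : ∀ᶠ z in cocompact ℂ, z ∈ L.outside := by
  obtain ⟨R, hR, hRb⟩ := L.trace_bound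
  filter_upwards [(tendsto_norm_cocompact_atTop (E := ℂ)).eventually_gt_atTop R] with z hz
  exact mem_outside_of_norm_gt hR hRb hz

theorem notMem_outside_iff {z : ℂ} : z ∉ L.outside ↔ z ∈ L.inside ∪ L.trace := by
  simp only [outside, inside, mem_ofPred_eq, mem_union]
  tauto

theorem notMem_outside_of_mem_inside {z : ℂ} (hz : z ∈ L.inside) : z ∉ L.outside :=
  fun h => h.2 hz.2

theorem cases_of_notMem_trace {z : ℂ} (hz : z ∉ L.trace) : z ∈ L.inside ∨ z ∈ L.outside := by
  simp only [outside, inside, mem_ofPred_eq]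
  tauto

/-! ### Cauchy-type integrals along a contour -/

theorem intervalIntegrable_deriv :
    IntervalIntegrable (deriv L.path) MeasureTheory.volume 0 1 := by
  obtain ⟨T, -, -, M, hM⟩ := L.piecewise
  rw [intervalIntegrable_iff, uIoc_of_le zero_le_one]
  refine MeasureTheory.Measure.integrableOn_of_bounded (M := M) (by simp)
    (measurable_deriv _).aestronglyMeasurable ?_
  rw [MeasureTheory.ae_restrict_iff' measurableSet_Ioc]
  have hT : ∀ᵐ t : ℝ, t ∉ ((T : Set ℝ) ∪ {1}) :=
    ((T.countable_toSet.union (countable_singleton 1)).ae_notMem _)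
  filter_upwards [hT] with t ht hIoc
  refine hM t ⟨⟨hIoc.1, lt_of_le_of_ne hIoc.2 fun h => ht (Or.inr h)⟩, fun h => ht (Or.inl h)⟩

theorem continuousOn_comp_path {g : ℂ → ℂ} (hg : ContinuousOn g L.trace) :
    ContinuousOn (fun t => g (L.path t)) (Icc 0 1) :=
  hg.comp L.cont fun _ ht => L.path_mem_trace ht

theorem integrable_of_continuousOn {g : ℂ → ℂ} (hg : ContinuousOn g L.trace) :
    L.Integrable g :=
  intervalIntegrable_deriv.continuousOn_mul
    (by rw [uIcc_of_le zero_le_one]; exact continuousOn_comp_path hg)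

theorem ne_of_notMem_trace {z σ : ℂ} (hz : z ∉ L.trace) (hσ : σ ∈ L.trace) : σ - z ≠ 0 :=
  sub_ne_zero.2 fun h => hz (h ▸ hσ)

theorem continuousOn_inv_sub {z : ℂ} (hz : z ∉ L.trace) :
    ContinuousOn (fun σ => (σ - z)⁻¹) L.trace :=
  (continuousOn_id.sub continuousOn_const).inv₀ fun _ hσ => ne_of_notMem_trace hz hσ

/-- The Cauchy-type integral of an integrable density is holomorphic off the contour. -/
theorem differentiableOn_cauchy {φ : ℝ → ℂ}
    (hφ : IntervalIntegrable φ MeasureTheory.volume 0 1) :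
    DifferentiableOn ℂ (fun z => ∫ t in (0 : ℝ)..1, φ t * (L.path t - z)⁻¹) L.traceᶜ := by
  refine differentiableOn_integral_mul hφ (k := fun z t => (L.path t - z)⁻¹) ?_ ?_ ?_
  · intro z hz
    exact continuousOn_comp_path (g := fun σ => (σ - z)⁻¹) (continuousOn_inv_sub hz)
  · intro t ht z hz
    refine DifferentiableAt.differentiableWithinAt ?_
    exact (differentiableAt_id.const_sub _).inv
      (ne_of_notMem_trace hz (L.path_mem_trace ht))
  · intro z₀ hz₀
    obtain ⟨ε, hε, hb⟩ := Metric.isOpen_iff.1 L.isOpen_compl_trace z₀ hz₀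
    have hdist : ∀ σ ∈ L.trace, ε ≤ ‖σ - z₀‖ := by
      intro σ hσ
      by_contra! h
      exact hb (by rwa [Metric.mem_ball, dist_eq_norm]) hσ
    refine ⟨ε / 2, half_pos hε, (Metric.ball_subset_ball (by linarith)).trans hb, (ε / 2)⁻¹, ?_⟩
    intro z hz t ht
    rw [norm_inv]
    refine inv_anti₀ (half_pos hε) ?_
    have h1 := hdist _ (L.path_mem_trace ht)
    rw [Metric.mem_ball, dist_eq_norm] at hz
    have h2 : ‖L.path t - z₀‖ ≤ ‖L.path t - z‖ + ‖z - z₀‖ := by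
      simpa using norm_add_le (L.path t - z) (z - z₀)
    linarith

theorem tendsto_cauchy {φ : ℝ → ℂ}
    (hφ : IntervalIntegrable φ MeasureTheory.volume 0 1) :
    Tendsto (fun z => ∫ t in (0 : ℝ)..1, φ t * (L.path t - z)⁻¹) (cocompact ℂ) (𝓝 0) := by
  obtain ⟨R, hR, hRb⟩ := L.trace_bound
  have hn := tendsto_norm_cocompact_atTop (E := ℂ)
  have hlim : Tendsto (fun z : ℂ => (∫ t in (0 : ℝ)..1, ‖φ t‖) * (‖z‖ - R)⁻¹)
      (cocompact ℂ) (𝓝 0) := by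
    have h1 : Tendsto (fun z : ℂ => ‖z‖ - R) (cocompact ℂ) atTop :=
      tendsto_atTop_add_const_right _ (-R) hn
    simpa using (tendsto_inv_atTop_zero.comp h1).const_mul (∫ t in (0 : ℝ)..1, ‖φ t‖)
  refine squeeze_zero_norm' ?_ hlim
  filter_upwards [hn.eventually_gt_atTop R] with z hz
  rw [← intervalIntegral.integral_mul_const]
  refine intervalIntegral.norm_integral_le_of_norm_le zero_le_one ?_ (hφ.norm.mul_const _)
  refine Eventually.of_forall fun t ht => ?_
  rw [norm_mul, norm_inv]
  refine mul_le_mul_of_nonneg_left (inv_anti₀ (by linarith) ?_) (norm_nonneg _)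
  have h1 := hRb _ (L.path_mem_trace (Ioc_subset_Icc_self ht))
  have h2 := norm_sub_norm_le z (L.path t)
  rw [norm_sub_rev] at h2
  linarith

/-- The Cauchy-type integral is `O(1/z)` at infinity, with a limit after multiplication by `z`. -/
theorem tendsto_mul_cauchy {φ : ℝ → ℂ}
    (hφ : IntervalIntegrable φ MeasureTheory.volume 0 1) :
    ∃ α, Tendsto (fun z => z * ∫ t in (0 : ℝ)..1, φ t * (L.path t - z)⁻¹)
      (cocompact ℂ) (𝓝 α) := by
  have hc : ContinuousOn L.path (uIcc 0 1) := by rw [uIcc_of_le zero_le_one]; exact L.cont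
  have hφ2 : IntervalIntegrable (fun t => φ t * L.path t) MeasureTheory.volume 0 1 :=
    hφ.mul_continuousOn hc
  refine ⟨-(∫ t in (0 : ℝ)..1, φ t) + 0, ?_⟩
  refine ((tendsto_cauchy (L := L) hφ2).const_add (-(∫ t in (0 : ℝ)..1, φ t))).congr' ?_
  filter_upwards [eventually_mem_outside (L := L)] with z hz
  rw [← intervalIntegral.integral_const_mul, ← intervalIntegral.integral_neg,
    ← intervalIntegral.integral_add (f := fun t => -φ t) hφ.neg]
  · refine intervalIntegral.integral_congr fun t ht => ?_
    rw [uIcc_of_le zero_le_one] at ht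
    have := ne_of_notMem_trace hz.1 (L.path_mem_trace ht)
    field_simp
    ring
  · refine hφ2.mul_continuousOn ?_
    rw [uIcc_of_le zero_le_one]
    exact continuousOn_comp_path (g := fun σ => (σ - z)⁻¹) (continuousOn_inv_sub hz.1)

/-- Replacing the Cauchy kernel by the difference quotient of a function holomorphic near the
contour removes the singularity on the contour. -/
theorem differentiableOn_integral_dslope {φ : ℝ → ℂ}
    (hφ : IntervalIntegrable φ MeasureTheory.volume 0 1) {f : ℂ → ℂ} {W : Set ℂ}
    (hW : IsOpen W) (hLW : L.trace ⊆ W) (hf : DifferentiableOn ℂ f W) :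
    DifferentiableOn ℂ (fun z => ∫ t in (0 : ℝ)..1, φ t * dslope f z (L.path t)) W := by
  have hds : ∀ c ∈ W, DifferentiableOn ℂ (dslope f c) W := fun c hc =>
    (Complex.differentiableOn_dslope (hW.mem_nhds hc)).2 hf
  refine differentiableOn_integral_mul hφ (k := fun z t => dslope f z (L.path t)) ?_ ?_ ?_
  · intro z hz
    exact continuousOn_comp_path ((hds z hz).continuousOn.mono hLW)
  · intro t ht
    simp_rw [dslope_comm f _ (L.path t)]
    exact hds _ (hLW (L.path_mem_trace ht))
  · intro z₀ hz₀
    obtain ⟨ε, hε, hb⟩ := Metric.nhds_basis_closedBall.mem_iff.1 (hW.mem_nhds hz₀)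
    have hder : ContinuousOn (deriv f) W := (hf.deriv hW).continuousOn
    obtain ⟨C₁, hC₁⟩ := (isCompact_closedBall z₀ ε).exists_bound_of_continuousOn
      (hder.mono hb)
    obtain ⟨C₂, hC₂⟩ := (isCompact_closedBall z₀ ε).exists_bound_of_continuousOn
      (hf.continuousOn.mono hb)
    obtain ⟨C₃, hC₃⟩ := L.isCompact_trace.exists_bound_of_continuousOn (hf.continuousOn.mono hLW)
    refine ⟨ε / 2, half_pos hε, fun z hz => hb (Metric.ball_subset_closedBall
      (Metric.ball_subset_ball (by linarith) hz)), max C₁ ((C₃ + C₂) / (ε / 2)), ?_⟩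
    intro z hz t ht
    have hzε : z ∈ Metric.closedBall z₀ ε :=
      Metric.ball_subset_closedBall (Metric.ball_subset_ball (by linarith) hz)
    have hσ := L.path_mem_trace ht
    by_cases hs : L.path t ∈ Metric.closedBall z₀ ε
    · refine le_max_of_le_left ?_
      rcases eq_or_ne (L.path t) z with h | h
      · rw [h, dslope_same]
        exact hC₁ z hzε
      · have h1 := (convex_closedBall z₀ ε).norm_image_sub_le_of_norm_deriv_le
          (fun x hx => hf.differentiableAt (hW.mem_nhds (hb hx))) hC₁ hzε hs
        rw [dslope_of_ne _ h, slope_def_module, norm_smul, norm_inv,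
          inv_mul_le_iff₀ (norm_pos_iff.2 (sub_ne_zero.2 h))]
        linarith
    · refine le_max_of_le_right ?_
      have h2 : ε / 2 ≤ ‖L.path t - z‖ := by
        rw [Metric.mem_closedBall, dist_eq_norm, not_le] at hs
        rw [Metric.mem_ball, dist_eq_norm] at hz
        have := norm_add_le (L.path t - z) (z - z₀)
        rw [sub_add_sub_cancel] at this
        linarith
      have h : L.path t ≠ z := by
        intro h
        rw [h, sub_self, norm_zero] at h2
        linarith
      rw [dslope_of_ne _ h, slope_def_module, norm_smul, norm_inv, ← div_eq_inv_mul]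
      refine div_le_div₀ ?_ ?_ (half_pos hε) h2
      · exact add_nonneg ((norm_nonneg _).trans (hC₃ _ hσ)) ((norm_nonneg _).trans (hC₂ _ hzε))
      · exact (norm_sub_le _ _).trans (add_le_add (hC₃ _ hσ) (hC₂ _ hzε))

theorem integral_mul_eq (g k : ℂ → ℂ) :
    L.integral (fun σ => g σ * k σ)
      = ∫ t in (0 : ℝ)..1, (g (L.path t) * deriv L.path t) * k (L.path t) := by
  unfold ClosedContour.integral
  congr 1
  ext t
  ring

theorem integral_congr {g h : ℂ → ℂ} (H : ∀ σ ∈ L.trace, g σ = h σ) :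
    L.integral g = L.integral h := by
  refine intervalIntegral.integral_congr fun t ht => ?_
  rw [uIcc_of_le zero_le_one] at ht
  simp only [H _ (L.path_mem_trace ht)]

theorem integral_add {g h : ℂ → ℂ} (hg : L.Integrable g) (hh : L.Integrable h) :
    L.integral (fun σ => g σ + h σ) = L.integral g + L.integral h := by
  unfold ClosedContour.integral
  rw [← intervalIntegral.integral_add hg hh]
  simp only [add_mul]

theorem integral_const_mul (c : ℂ) (g : ℂ → ℂ) :
    L.integral (fun σ => c * g σ) = c * L.integral g := by
  unfold ClosedContour.integral
  rw [← intervalIntegral.integral_const_mul]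
  simp only [mul_assoc]

theorem integral_sub {g h : ℂ → ℂ} (hg : L.Integrable g) (hh : L.Integrable h) :
    L.integral (fun σ => g σ - h σ) = L.integral g - L.integral h := by
  unfold ClosedContour.integral
  rw [← intervalIntegral.integral_sub hg hh]
  simp only [sub_mul]

theorem integral_finset_sum {ι : Type*} (s : Finset ι) {g : ι → ℂ → ℂ}
    (hg : ∀ i ∈ s, L.Integrable (g i)) :
    L.integral (fun σ => ∑ i ∈ s, g i σ) = ∑ i ∈ s, L.integral (g i) := by
  unfold ClosedContour.integral
  rw [← intervalIntegral.integral_finsetSum hg]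
  simp only [Finset.sum_mul]

theorem Integrable.mul_continuousOn {g k : ℂ → ℂ} (hg : L.Integrable g)
    (hk : ContinuousOn k L.trace) : L.Integrable (fun σ => g σ * k σ) := by
  have h := IntervalIntegrable.mul_continuousOn hg (g := fun t => k (L.path t))
    (by rw [uIcc_of_le zero_le_one]; exact continuousOn_comp_path hk)
  refine IntervalIntegrable.congr (fun t _ => ?_) h
  simp only
  ring

theorem Integrable.const_mul {g : ℂ → ℂ} (hg : L.Integrable g) (c : ℂ) :
    L.Integrable (fun σ => c * g σ) := by
  refine IntervalIntegrable.congr (fun t _ => ?_) (IntervalIntegrable.const_mul hg c)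
  simp only
  ring

theorem Integrable.mul_inv_sub {g : ℂ → ℂ} (hg : L.Integrable g) {w : ℂ} (hw : w ∉ L.trace) :
    L.Integrable (fun σ => g σ * (σ - w)⁻¹) :=
  hg.mul_continuousOn (continuousOn_inv_sub hw)

theorem differentiableOn_cauchyIntegral {g : ℂ → ℂ} (hg : L.Integrable g) :
    DifferentiableOn ℂ (fun w => L.integral fun σ => g σ * (σ - w)⁻¹) L.traceᶜ := by
  simp only [fun w => integral_mul_eq (L := L) g (fun σ => (σ - w)⁻¹)]
  exact differentiableOn_cauchy hg

theorem tendsto_cauchyIntegral {g : ℂ → ℂ} (hg : L.Integrable g) :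
    Tendsto (fun w => L.integral fun σ => g σ * (σ - w)⁻¹) (cocompact ℂ) (𝓝 0) := by
  simp only [fun w => integral_mul_eq (L := L) g (fun σ => (σ - w)⁻¹)]
  exact tendsto_cauchy hg

theorem tendsto_mul_cauchyIntegral {g : ℂ → ℂ} (hg : L.Integrable g) :
    ∃ α, Tendsto (fun w => w * L.integral fun σ => g σ * (σ - w)⁻¹) (cocompact ℂ) (𝓝 α) := by
  simp only [fun w => integral_mul_eq (L := L) g (fun σ => (σ - w)⁻¹)]
  exact tendsto_mul_cauchy hg

/-- The primitive `log (1 - σ / z)` of the Cauchy kernel exists on a disc that contains the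
contour. -/
theorem integral_inv_sub_of_norm_gt {R : ℝ} (hRb : ∀ z ∈ L.trace, ‖z‖ ≤ R) {z : ℂ}
    (hz : R < ‖z‖) (hz0 : z ≠ 0) : L.integral (fun σ => (σ - z)⁻¹) = 0 := by
  have hzt : z ∉ L.trace := fun h => absurd (hRb z h) (not_le.2 hz)
  have hslit : ∀ σ ∈ L.trace, 1 - σ / z ∈ Complex.slitPlane := by
    intro σ hσ
    rw [sub_eq_add_neg]
    refine Complex.mem_slitPlane_of_norm_lt_one ?_
    rw [norm_neg, norm_div, div_lt_one (norm_pos_iff.2 hz0)]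
    exact (hRb σ hσ).trans_lt hz
  obtain ⟨T, hT, -, -⟩ := L.piecewise
  have h := MeasureTheory.integral_eq_of_hasDerivAt_off_countable
    (fun t => Complex.log (1 - L.path t / z)) (fun t => (L.path t - z)⁻¹ * deriv L.path t)
    (a := 0) (b := 1) T.countable_toSet ?_ ?_ ?_
  · unfold ClosedContour.integral
    rw [h, L.closed, sub_self]
  · rw [uIcc_of_le zero_le_one]
    exact ContinuousOn.clog (continuousOn_const.sub (L.cont.div_const _))
      fun t ht => hslit _ (L.path_mem_trace ht)
  · intro t ht
    rw [min_eq_left zero_le_one, max_eq_right zero_le_one] at ht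
    have hmem := L.path_mem_trace (Ioo_subset_Icc_self ht.1)
    have h1 := (((hT t ht).hasDerivAt.div_const z).const_sub 1).clog_real (hslit _ hmem)
    refine h1.congr_deriv ?_
    have h2 := ne_of_notMem_trace hzt hmem
    have h3 : z - L.path t ≠ 0 := by rw [← neg_sub]; exact neg_ne_zero.2 h2
    have h4 : 1 - L.path t / z = (z - L.path t) / z := by field_simp
    rw [h4, ← neg_sub z]
    field_simp
  · exact integrable_of_continuousOn (continuousOn_inv_sub hzt)

theorem integrable_inv_sub {w : ℂ} (hw : w ∉ L.trace) : L.Integrable (fun σ => (σ - w)⁻¹) :=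
  integrable_of_continuousOn (continuousOn_inv_sub hw)

/-- The contour does not wind around the points outside. -/
theorem integral_inv_sub_of_mem_outside {z : ℂ} (hz : z ∈ L.outside) :
    L.integral (fun σ => (σ - z)⁻¹) = 0 := by
  obtain ⟨R, hR, hRb⟩ := L.trace_bound
  have h1 : L.Integrable (fun _ => 1) := integrable_of_continuousOn continuousOn_const
  have hd := (differentiableOn_cauchyIntegral h1).mono
    (fun w (hw : w ∈ L.outside) => (hw.1 : w ∈ L.traceᶜ))
  simp only [one_mul] at hd
  have hw : R < ‖((R + 1 : ℝ) : ℂ)‖ := by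
    rw [Complex.norm_real, Real.norm_eq_abs]
    exact lt_of_lt_of_le (by linarith) (le_abs_self _)
  refine (hd.analyticOnNhd isOpen_outside).eqOn_zero_of_preconnected_of_eventuallyEq_zero
    isPreconnected_outside (mem_outside_of_norm_gt hR hRb hw) ?_ hz
  filter_upwards [(isOpen_lt continuous_const continuous_norm).mem_nhds hw] with u hu
  refine integral_inv_sub_of_norm_gt hRb hu ?_
  rintro rfl
  simp only [norm_zero] at hu
  linarith

/-! ### Cauchy's theorem and the residue theorem -/

/-- Cauchy's theorem by Dixon's argument: the Cauchy integral outside the contour and the integral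
of the difference quotient near the closed interior fit together to an entire function that
vanishes at infinity. -/
theorem cauchyIntegral_eq_zero {W : Set ℂ} (hW : IsOpen W) (hsub : L.inside ∪ L.trace ⊆ W)
    {f : ℂ → ℂ} (hf : DifferentiableOn ℂ f W) {w : ℂ} (hw : w ∈ L.outside) :
    L.integral (fun σ => f σ * (σ - w)⁻¹) = 0 := by
  classical
  have hLW : L.trace ⊆ W := subset_union_right.trans hsub
  have hfi : L.Integrable f := integrable_of_continuousOn (hf.continuousOn.mono hLW)
  set D : ℂ → ℂ := fun z => ∫ t in (0 : ℝ)..1, deriv L.path t * dslope f z (L.path t) with hD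
  set J : ℂ → ℂ := fun z => L.integral (fun σ => f σ * (σ - z)⁻¹) with hJ
  have hDd : DifferentiableOn ℂ D W :=
    differentiableOn_integral_dslope intervalIntegrable_deriv hW hLW hf
  have hJd : DifferentiableOn ℂ J L.traceᶜ := differentiableOn_cauchyIntegral hfi
  have hDJ : ∀ z ∈ L.outside, D z = J z := by
    intro z hz
    have h1 : D z = L.integral (fun σ => f σ * (σ - z)⁻¹ - f z * (σ - z)⁻¹) := by
      refine intervalIntegral.integral_congr fun t ht => ?_
      rw [uIcc_of_le zero_le_one] at ht
      have hne := ne_of_notMem_trace hz.1 (L.path_mem_trace ht)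
      simp only
      rw [dslope_of_ne _ (sub_ne_zero.1 hne), slope_def_field]
      field_simp
    rw [h1, integral_sub (hfi.mul_inv_sub hz.1)
      ((integrable_of_continuousOn (continuousOn_inv_sub hz.1)).const_mul _),
      integral_const_mul, integral_inv_sub_of_mem_outside hz, mul_zero, sub_zero]
  set F : ℂ → ℂ := fun z => if z ∈ L.outside then J z else D z with hF
  have hFd : Differentiable ℂ F := by
    intro z
    by_cases hz : z ∈ L.outside
    · refine (hJd.differentiableAt (L.isOpen_compl_trace.mem_nhds hz.1)).congr_of_eventuallyEq ?_
      filter_upwards [isOpen_outside.mem_nhds hz] with u hu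
      simp [hF, hu]
    · have hzW : z ∈ W := hsub (notMem_outside_iff.1 hz)
      refine (hDd.differentiableAt (hW.mem_nhds hzW)).congr_of_eventuallyEq ?_
      filter_upwards with u
      by_cases hu : u ∈ L.outside
      · simp [hF, hu, hDJ u hu]
      · simp [hF, hu]
  have hlim : Tendsto F (cocompact ℂ) (𝓝 0) := by
    refine (tendsto_cauchyIntegral hfi).congr' ?_
    filter_upwards [eventually_mem_outside (L := L)] with u hu
    simp [hF, hJ, hu]
  have h0 := hFd.apply_eq_of_tendsto_cocompact w hlim
  simpa [hF, hw] using h0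

/-- The residue theorem for a quotient `f / A` whose denominator has simple zeros, with the Cauchy
kernel at a point outside. -/
theorem cauchyIntegral_div (hL : L.PositivelyOriented) {W : Set ℂ} (hW : IsOpen W)
    (hsub : L.inside ∪ L.trace ⊆ W) {f A : ℂ → ℂ} (hf : DifferentiableOn ℂ f W)
    (hA : DifferentiableOn ℂ A W) (Z : Finset ℂ) (hZ : ∀ z ∈ Z, z ∈ L.inside)
    (hZA : ∀ z ∈ W, A z = 0 ↔ z ∈ Z) (hsimple : ∀ z ∈ Z, deriv A z ≠ 0) {w : ℂ}
    (hw : w ∈ L.outside) :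
    L.integral (fun σ => f σ / A σ * (σ - w)⁻¹)
      = 2 * Real.pi * Complex.I * ∑ z ∈ Z, f z / deriv A z * (z - w)⁻¹ := by
  classical
  set r : ℂ → ℂ := fun z => f z / deriv A z with hr
  -- the regular part of `f / A`, with its singularities at the zeros removed
  set Y : ℂ → ℂ := fun σ =>
    if σ ∈ Z then dslope (fun τ => f τ / dslope A σ τ) σ σ - ∑ k ∈ Z.erase σ, r k * (σ - k)⁻¹
    else f σ / A σ - ∑ k ∈ Z, r k * (σ - k)⁻¹ with hY
  have hsum : ∀ (s : Finset ℂ) (z : ℂ), z ∉ s →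
      DifferentiableAt ℂ (fun σ => ∑ k ∈ s, r k * (σ - k)⁻¹) z := by
    intro s z hz
    refine DifferentiableAt.fun_sum fun k hk => ?_
    refine ((differentiableAt_id.sub_const k).inv ?_).const_mul _
    exact sub_ne_zero.2 fun h => hz ((show z = k from h) ▸ hk)
  have hYd : DifferentiableOn ℂ Y W := by
    intro z hz
    refine DifferentiableAt.differentiableWithinAt ?_
    by_cases hzZ : z ∈ Z
    · have hAz : A z = 0 := (hZA z hz).2 hzZ
      have had : DifferentiableOn ℂ (dslope A z) W :=
        (Complex.differentiableOn_dslope (hW.mem_nhds hz)).2 hA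
      have hane : ∀ᶠ σ in 𝓝 z, dslope A z σ ≠ 0 := by
        have hc : ContinuousAt (dslope A z) z :=
          (had.differentiableAt (hW.mem_nhds hz)).continuousAt
        refine hc.eventually_ne ?_
        rw [dslope_same]
        exact hsimple z hzZ
      have hV : {σ | σ ∈ W ∧ dslope A z σ ≠ 0} ∈ 𝓝 z := inter_mem (hW.mem_nhds hz) hane
      have hq : DifferentiableOn ℂ (fun τ => f τ / dslope A z τ)
          {σ | σ ∈ W ∧ dslope A z σ ≠ 0} :=
        (hf.mono fun σ hσ => hσ.1).div (had.mono fun σ hσ => hσ.1) fun σ hσ => hσ.2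
      have hqd : DifferentiableAt ℂ (dslope (fun τ => f τ / dslope A z τ) z) z :=
        ((Complex.differentiableOn_dslope hV).2 hq).differentiableAt hV
      have hE : ∀ᶠ σ in 𝓝 z, σ ∉ Z.erase z :=
        (Z.erase z).finite_toSet.isClosed.isOpen_compl.mem_nhds (by simp)
      refine (hqd.sub (hsum (Z.erase z) z (by simp))).congr_of_eventuallyEq ?_
      filter_upwards [hE, hW.mem_nhds hz] with σ hσE hσW
      by_cases hσz : σ = z
      · subst hσz
        simp only [hY, hzZ, if_true, Pi.sub_apply]
      · have hσZ : σ ∉ Z := fun h => hσE (Finset.mem_erase.2 ⟨hσz, h⟩)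
        have hAσ : A σ ≠ 0 := fun h => hσZ ((hZA σ hσW).1 h)
        have hne : σ - z ≠ 0 := sub_ne_zero.2 hσz
        simp only [hY, hσZ, if_false, Pi.sub_apply]
        rw [← Finset.add_sum_erase _ _ hzZ, dslope_of_ne _ hσz, slope_def_field, dslope_same,
          dslope_of_ne _ hσz, slope_def_field, hAz, sub_zero]
        simp only [hr]
        have := hsimple z hzZ
        field_simp
        ring
    · have hAz : A z ≠ 0 := fun h => hzZ ((hZA z hz).1 h)
      have h1 := ((hf.differentiableAt (hW.mem_nhds hz)).div
        (hA.differentiableAt (hW.mem_nhds hz)) hAz).sub (hsum Z z hzZ)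
      refine h1.congr_of_eventuallyEq ?_
      have hE : ∀ᶠ σ in 𝓝 z, σ ∉ Z :=
        Z.finite_toSet.isClosed.isOpen_compl.mem_nhds (by simpa using hzZ)
      filter_upwards [hE] with σ hσ
      simp only [hY, hσ, if_false, Pi.sub_apply, Pi.div_apply]
  have hLW : L.trace ⊆ W := subset_union_right.trans hsub
  have hdec : ∀ σ ∈ L.trace, f σ / A σ * (σ - w)⁻¹
      = Y σ * (σ - w)⁻¹ + ∑ k ∈ Z, r k * (k - w)⁻¹ * ((σ - k)⁻¹ - (σ - w)⁻¹) := by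
    intro σ hσ
    have hσZ : σ ∉ Z := fun h => (hZ σ h).1 hσ
    have hσw := ne_of_notMem_trace hw.1 hσ
    simp only [hY, hσZ, if_false]
    rw [sub_mul, Finset.sum_mul, sub_add, ← Finset.sum_sub_distrib]
    rw [Finset.sum_eq_zero, sub_zero]
    intro k hk
    have h1 := ne_of_notMem_trace (hZ k hk).1 hσ
    have h2 : k - w ≠ 0 := sub_ne_zero.2 fun h => notMem_outside_of_mem_inside (hZ k hk) (h ▸ hw)
    field_simp
    ring
  have hker : ∀ k ∈ Z, ContinuousOn (fun σ => (σ - k)⁻¹ - (σ - w)⁻¹) L.trace := fun k hk =>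
    (continuousOn_inv_sub (hZ k hk).1).sub (continuousOn_inv_sub hw.1)
  rw [integral_congr hdec, integral_add
    ((integrable_of_continuousOn (hYd.continuousOn.mono hLW)).mul_inv_sub hw.1)
    (integrable_of_continuousOn (g := fun σ => ∑ k ∈ Z, r k * (k - w)⁻¹ * ((σ - k)⁻¹ - (σ - w)⁻¹))
      (continuousOn_finsetSum _ fun k hk => continuousOn_const.mul (hker k hk))),
    cauchyIntegral_eq_zero hW hsub hYd hw, zero_add, integral_finset_sum _
    (fun k hk => (integrable_of_continuousOn (hker k hk)).const_mul _),
    Finset.mul_sum]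
  refine Finset.sum_congr rfl fun k hk => ?_
  rw [integral_const_mul, integral_sub (integrable_inv_sub (hZ k hk).1)
    (integrable_inv_sub hw.1), hL k (hZ k hk), integral_inv_sub_of_mem_outside hw]
  simp only [hr]
  ring

/-! ### Functions represented by the exterior Cauchy formula -/

/-- `g` is given outside the contour by the Cauchy formula for the exterior domain, with the value
`c` at infinity. Only continuity is required on the contour itself; holomorphy of `g` outside and
the limit `c` at infinity are consequences. -/
structure IsExteriorCauchy (L : ClosedContour) (g : ℂ → ℂ) (c : ℂ) : Prop where
  cont : ContinuousOn g L.trace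
  outside : ∀ w ∈ L.outside,
    L.integral (fun σ => g σ * (σ - w)⁻¹) = 2 * Real.pi * Complex.I * (c - g w)
  inside : ∀ w ∈ L.inside,
    L.integral (fun σ => g σ * (σ - w)⁻¹) = 2 * Real.pi * Complex.I * c

namespace IsExteriorCauchy

variable {g h : ℂ → ℂ} {c d : ℂ}

theorem integrable (hg : L.IsExteriorCauchy g c) : L.Integrable g :=
  integrable_of_continuousOn hg.cont

theorem congr (hg : L.IsExteriorCauchy g c) (H : ∀ σ ∈ L.outside ∪ L.trace, h σ = g σ) :
    L.IsExteriorCauchy h c := by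
  have hi : ∀ w, L.integral (fun σ => h σ * (σ - w)⁻¹) = L.integral (fun σ => g σ * (σ - w)⁻¹) :=
    fun w => integral_congr fun σ hσ => by rw [H σ (Or.inr hσ)]
  refine ⟨hg.cont.congr fun σ hσ => H σ (Or.inr hσ), fun w hw => ?_, fun w hw => ?_⟩
  · rw [hi, hg.outside w hw, H w (Or.inl hw)]
  · rw [hi, hg.inside w hw]

theorem const (hL : L.PositivelyOriented) (c : ℂ) : L.IsExteriorCauchy (fun _ => c) c := by
  refine ⟨continuousOn_const, fun w hw => ?_, fun w hw => ?_⟩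
  · rw [integral_const_mul, integral_inv_sub_of_mem_outside hw, sub_self, mul_zero, mul_zero]
  · rw [integral_const_mul, hL w hw, mul_comm]

theorem add (hg : L.IsExteriorCauchy g c) (hh : L.IsExteriorCauchy h d) :
    L.IsExteriorCauchy (fun σ => g σ + h σ) (c + d) := by
  have hi : ∀ w ∉ L.trace, L.integral (fun σ => (g σ + h σ) * (σ - w)⁻¹)
      = L.integral (fun σ => g σ * (σ - w)⁻¹) + L.integral (fun σ => h σ * (σ - w)⁻¹) := by
    intro w hw
    rw [← integral_add (hg.integrable.mul_inv_sub hw) (hh.integrable.mul_inv_sub hw)]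
    simp only [add_mul]
  refine ⟨hg.cont.add hh.cont, fun w hw => ?_, fun w hw => ?_⟩
  · rw [hi w hw.1, hg.outside w hw, hh.outside w hw]; ring
  · rw [hi w hw.1, hg.inside w hw, hh.inside w hw]; ring

theorem const_mul (hg : L.IsExteriorCauchy g c) (a : ℂ) :
    L.IsExteriorCauchy (fun σ => a * g σ) (a * c) := by
  have hi : ∀ w, L.integral (fun σ => a * g σ * (σ - w)⁻¹)
      = a * L.integral (fun σ => g σ * (σ - w)⁻¹) := by
    intro w
    rw [← integral_const_mul]
    simp only [mul_assoc]
  refine ⟨continuousOn_const.mul hg.cont, fun w hw => ?_, fun w hw => ?_⟩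
  · rw [hi, hg.outside w hw]; ring
  · rw [hi, hg.inside w hw]; ring

theorem differentiableOn (hg : L.IsExteriorCauchy g c) : DifferentiableOn ℂ g L.outside := by
  have hd := (differentiableOn_cauchyIntegral hg.integrable).mono
    (fun w (hw : w ∈ L.outside) => (hw.1 : w ∈ L.traceᶜ))
  refine ((hd.const_mul (2 * Real.pi * Complex.I)⁻¹).const_sub c).congr fun w hw => ?_
  have := Complex.two_pi_I_ne_zero
  simp only [hg.outside w hw]
  field_simp
  ring

theorem tendsto (hg : L.IsExteriorCauchy g c) : Tendsto g (cocompact ℂ) (𝓝 c) := by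
  have h := ((tendsto_cauchyIntegral hg.integrable).const_mul
    (2 * Real.pi * Complex.I)⁻¹).const_sub c
  rw [mul_zero, sub_zero] at h
  refine h.congr' ?_
  filter_upwards [eventually_mem_outside (L := L)] with w hw
  have := Complex.two_pi_I_ne_zero
  rw [hg.outside w hw]
  field_simp
  ring

/-- Division by a linear factor preserves the exterior Cauchy formula. If the zero of the factor
lies outside, the quotient is assumed to be continuous there. -/
theorem of_sub_mul_eq (hh : L.IsExteriorCauchy h c) {a : ℂ} (ha : a ∉ L.trace) {k : ℂ → ℂ}
    (hk : ContinuousOn k L.trace) (hkh : ∀ σ ∈ L.outside ∪ L.trace, (σ - a) * k σ = h σ)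
    (hka : a ∈ L.outside → ContinuousAt k a) : L.IsExteriorCauchy k 0 := by
  have hki : L.Integrable k := integrable_of_continuousOn hk
  have hJa : L.integral (fun σ => h σ * (σ - a)⁻¹) = 2 * Real.pi * Complex.I * c := by
    rcases cases_of_notMem_trace ha with h1 | h1
    · exact hh.inside a h1
    · rw [hh.outside a h1, ← hkh a (Or.inl h1), sub_self, zero_mul, sub_zero]
  have hne : ∀ w ∉ L.trace, w ≠ a → L.integral (fun σ => k σ * (σ - w)⁻¹)
      = (a - w)⁻¹ * (2 * Real.pi * Complex.I * c - L.integral (fun σ => h σ * (σ - w)⁻¹)) := by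
    intro w hw hwa
    rw [← hJa, ← integral_sub (hh.integrable.mul_inv_sub ha) (hh.integrable.mul_inv_sub hw),
      ← integral_const_mul]
    refine integral_congr fun σ hσ => ?_
    rw [← hkh σ (Or.inr hσ)]
    have h1 := ne_of_notMem_trace ha hσ
    have h2 := ne_of_notMem_trace hw hσ
    have h3 : a - w ≠ 0 := sub_ne_zero.2 hwa.symm
    field_simp
    ring
  have hout : ∀ w ∈ L.outside, w ≠ a →
      L.integral (fun σ => k σ * (σ - w)⁻¹) = 2 * Real.pi * Complex.I * (0 - k w) := by
    intro w hw hwa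
    rw [hne w hw.1 hwa, hh.outside w hw, ← hkh w (Or.inl hw)]
    have h3 : a - w ≠ 0 := sub_ne_zero.2 hwa.symm
    field_simp
    ring
  have hins : ∀ w ∈ L.inside, w ≠ a → L.integral (fun σ => k σ * (σ - w)⁻¹) = 0 := by
    intro w hw hwa
    rw [hne w hw.1 hwa, hh.inside w hw, sub_self, mul_zero]
  -- the remaining point is reached by continuity
  have hcont : ContinuousAt (fun w => L.integral (fun σ => k σ * (σ - w)⁻¹)) a :=
    ((differentiableOn_cauchyIntegral hki).differentiableAt
      (L.isOpen_compl_trace.mem_nhds ha)).continuousAt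
  have hcont' : Tendsto (fun w => L.integral (fun σ => k σ * (σ - w)⁻¹)) (𝓝[≠] a)
      (𝓝 (L.integral (fun σ => k σ * (σ - a)⁻¹))) := hcont.tendsto.mono_left nhdsWithin_le_nhds
  refine ⟨hk, fun w hw => ?_, fun w hw => ?_⟩
  · by_cases hwa : w = a
    · subst hwa
      have h2 : Tendsto (fun w => 2 * Real.pi * Complex.I * (0 - k w)) (𝓝[≠] w)
          (𝓝 (2 * Real.pi * Complex.I * (0 - k w))) :=
        (((hka hw).tendsto.const_sub 0).const_mul _).mono_left nhdsWithin_le_nhds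
      refine tendsto_nhds_unique hcont' (h2.congr' ?_)
      filter_upwards [self_mem_nhdsWithin, nhdsWithin_le_nhds (isOpen_outside.mem_nhds hw)]
        with u hu hu'
      exact (hout u hu' hu).symm
    · exact hout w hw hwa
  · rw [mul_zero]
    by_cases hwa : w = a
    · subst hwa
      refine tendsto_nhds_unique hcont' (tendsto_const_nhds.congr' ?_)
      filter_upwards [self_mem_nhdsWithin, nhdsWithin_le_nhds (isOpen_inside.mem_nhds hw)]
        with u hu hu'
      exact (hins u hu' hu).symm
    · exact hins w hw hwa

/-- The exterior Cauchy formula passes to pointwise limits that are dominated on the contour. -/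
theorem of_tendsto {G : ℕ → ℂ → ℂ} (hG : ∀ n, L.IsExteriorCauchy (G n) c) {C : ℝ}
    (hC : ∀ n, ∀ σ ∈ L.trace, ‖G n σ‖ ≤ C) (hg : ContinuousOn g L.trace)
    (hlim : ∀ σ ∈ L.outside ∪ L.trace, Tendsto (fun n => G n σ) atTop (𝓝 (g σ))) :
    L.IsExteriorCauchy g c := by
  have hint : ∀ w ∉ L.trace, Tendsto (fun n => L.integral (fun σ => G n σ * (σ - w)⁻¹)) atTop
      (𝓝 (L.integral (fun σ => g σ * (σ - w)⁻¹))) := by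
    intro w hw
    have hIcc : ∀ t ∈ uIoc (0 : ℝ) 1, L.path t ∈ L.trace := fun t ht =>
      L.path_mem_trace (Ioc_subset_Icc_self (by rwa [uIoc_of_le zero_le_one] at ht))
    refine intervalIntegral.tendsto_integral_filter_of_dominated_convergence
      (fun t => ‖C‖ * ‖(L.path t - w)⁻¹ * deriv L.path t‖) ?_ ?_ ?_ ?_
    · refine Eventually.of_forall fun n => ?_
      exact (intervalIntegrable_iff.1
        ((hG n).integrable.mul_inv_sub hw)).aestronglyMeasurable
    · refine Eventually.of_forall fun n => Eventually.of_forall fun t ht => ?_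
      rw [mul_assoc, norm_mul]
      refine mul_le_mul_of_nonneg_right ?_ (norm_nonneg _)
      exact (hC n _ (hIcc t ht)).trans (le_abs_self C)
    · exact IntervalIntegrable.const_mul (integrable_inv_sub hw).norm _
    · refine Eventually.of_forall fun t ht => ?_
      exact ((hlim _ (Or.inr (hIcc t ht))).mul_const _).mul_const _
  refine ⟨hg, fun w hw => ?_, fun w hw => ?_⟩
  · refine tendsto_nhds_unique (hint w hw.1) ?_
    simp only [fun n => (hG n).outside w hw]
    exact ((hlim w (Or.inl hw)).const_sub c).const_mul _
  · refine tendsto_nhds_unique (hint w hw.1) ?_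
    simp only [fun n => (hG n).inside w hw]
    exact tendsto_const_nhds

end IsExteriorCauchy

end ClosedContour

/-! ### Stability of the staircase recurrence -/

/-- The weighted size at step `k` of a solution `x` of the staircase recurrence that starts at the
position `m`: the solution itself, plus its difference in the weight `K ^ (-i)` that belongs to the
position `i = m + k`. -/
noncomputable def stairEnergy (K : ℝ) (p : ℤ → ℂ) (ζ : ℂ) (m : ℤ) (x : ℕ → ℂ) (k : ℕ) : ℝ :=
  ‖x k‖ + K ^ (-(m + k)) * ‖(p (m + k) + ζ) * (x (k + 1) - x k)‖

theorem norm_le_stairEnergy {K : ℝ} (hK : 1 < K) (p : ℤ → ℂ) (ζ : ℂ) (m : ℤ) (x : ℕ → ℂ) (k : ℕ) :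
    ‖x k‖ ≤ stairEnergy K p ζ m x k :=
  le_add_of_nonneg_right (mul_nonneg (zpow_nonneg (by linarith) _) (norm_nonneg _))

theorem zpow_neg_le_pow_natAbs {K : ℝ} (hK : 1 < K) (i : ℤ) : K ^ (-i) ≤ K ^ i.natAbs := by
  rw [← zpow_natCast]
  exact zpow_le_zpow_right₀ hK.le (by omega)

/-- One step of the recurrence. In terms of the difference `(p i + ζ) (x (i + 1) - x i)` the
recurrence has the multiplier `(p i - ζ) / (p i + ζ)`, of modulus at most `K`, which the weight
absorbs. -/
theorem stairEnergy_succ_le {K : ℝ} (hK : 1 < K) {p υ : ℤ → ℂ} {ζ : ℂ} {c : ℝ} (hc : 0 < c)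
    (hcp : ∀ i, c ≤ ‖p i + ζ‖) (hP : ∀ i, ‖p i - ζ‖ ≤ K * ‖p i + ζ‖) {m : ℤ} {x : ℕ → ℂ}
    (hx : ∀ k : ℕ, (p (m + k + 1) + ζ) * x (k + 2)
      - (p (m + k) + p (m + k + 1) + υ (m + k + 1)) * x (k + 1) + (p (m + k) - ζ) * x k = 0)
    (k : ℕ) :
    stairEnergy K p ζ m x (k + 1) ≤ stairEnergy K p ζ m x k
      * Real.exp (K ^ (m + k) / c + ‖υ (m + k + 1)‖ * K ^ (m + k + 1).natAbs) := by
  have hK0 : 0 < K := by linarith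
  have hcast : (m + ((k + 1 : ℕ) : ℤ)) = m + k + 1 := by push_cast; ring
  unfold stairEnergy
  rw [hcast]
  set q := m + (k : ℤ) with hq
  have hpne : p q + ζ ≠ 0 := norm_pos_iff.1 (hc.trans_le (hcp q))
  set X := ‖x k‖
  set E := (p q + ζ) * (x (k + 1) - x k) with hE
  set F := K ^ (-q) * ‖E‖ with hF
  set a := K ^ q / c with ha
  set w := ‖υ (q + 1)‖ * K ^ (q + 1).natAbs with hw
  have hX0 : 0 ≤ X := norm_nonneg _
  have hF0 : 0 ≤ F := mul_nonneg (zpow_nonneg hK0.le _) (norm_nonneg _)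
  have ha0 : 0 ≤ a := div_nonneg (zpow_nonneg hK0.le _) hc.le
  have hw0 : 0 ≤ w := mul_nonneg (norm_nonneg _) (pow_nonneg hK0.le _)
  have hEF : ‖E‖ = K ^ q * F := by
    rw [hF, ← mul_assoc, ← zpow_add₀ hK0.ne', add_neg_cancel, zpow_zero, one_mul]
  have h1 : ‖x (k + 1)‖ ≤ X + a * F := by
    have h2 : x (k + 1) = x k + E / (p q + ζ) := by
      rw [hE]; field_simp; ring
    rw [h2]
    refine (norm_add_le _ _).trans (add_le_add le_rfl ?_)
    rw [norm_div, ha, div_mul_eq_mul_div, ← hEF]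
    exact div_le_div_of_nonneg_left (norm_nonneg _) hc (hcp q)
  have h3 : (p (q + 1) + ζ) * (x (k + 1 + 1) - x (k + 1))
      = (p q - ζ) / (p q + ζ) * E + υ (q + 1) * x (k + 1) := by
    have h4 : (p q - ζ) / (p q + ζ) * E = (p q - ζ) * (x (k + 1) - x k) := by
      rw [hE]; field_simp
    rw [h4]
    have := hx k
    linear_combination this
  have h5 : ‖(p q - ζ) / (p q + ζ) * E‖ ≤ K * ‖E‖ := by
    rw [norm_mul, norm_div]
    refine mul_le_mul_of_nonneg_right ?_ (norm_nonneg _)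
    rw [div_le_iff₀ (norm_pos_iff.2 hpne)]
    exact hP q
  have h6 : K ^ (-(q + 1)) * ‖(p (q + 1) + ζ) * (x (k + 1 + 1) - x (k + 1))‖
      ≤ F + w * ‖x (k + 1)‖ := by
    rw [h3]
    have h7 : K ^ (-(q + 1)) * (K * ‖E‖) = F := by
      rw [hF, ← mul_assoc, ← zpow_add_one₀ hK0.ne']
      congr 2
      ring
    calc _ ≤ K ^ (-(q + 1)) * (K * ‖E‖ + ‖υ (q + 1)‖ * ‖x (k + 1)‖) := by
          refine mul_le_mul_of_nonneg_left ?_ (zpow_nonneg hK0.le _)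
          exact (norm_add_le _ _).trans (add_le_add h5 (norm_mul _ _).le)
      _ = F + K ^ (-(q + 1)) * ‖υ (q + 1)‖ * ‖x (k + 1)‖ := by rw [mul_add, h7, mul_assoc]
      _ ≤ _ := by
          refine add_le_add le_rfl (mul_le_mul_of_nonneg_right ?_ (norm_nonneg _))
          rw [hw, mul_comm]
          exact mul_le_mul_of_nonneg_left (zpow_neg_le_pow_natAbs hK _) (norm_nonneg _)
  have h8 : 1 + a ≤ Real.exp a := by linarith [Real.add_one_le_exp a]
  have h9 : 1 + w ≤ Real.exp w := by linarith [Real.add_one_le_exp w]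
  calc _ ≤ ‖x (k + 1)‖ + (F + w * ‖x (k + 1)‖) := add_le_add le_rfl h6
    _ = ‖x (k + 1)‖ * (1 + w) + F := by ring
    _ ≤ (X + a * F) * (1 + w) + F := by gcongr
    _ ≤ (X + F) * ((1 + a) * (1 + w)) := by
        nlinarith [mul_nonneg hX0 ha0, mul_nonneg hF0 hw0, mul_nonneg (mul_nonneg hX0 ha0) hw0]
    _ ≤ (X + F) * (Real.exp a * Real.exp w) := by gcongr
    _ = _ := by rw [← Real.exp_add]

/-- The growth factor of the recurrence between a position `m` and a position `i ≥ m` does not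
depend on `m`. -/
theorem stairEnergy_le {K : ℝ} (hK : 1 < K) {p υ : ℤ → ℂ}
    (hs : Summable fun i : ℤ => ‖υ i‖ * K ^ i.natAbs) {ζ : ℂ} {c : ℝ} (hc : 0 < c)
    (hcp : ∀ i, c ≤ ‖p i + ζ‖) (hP : ∀ i, ‖p i - ζ‖ ≤ K * ‖p i + ζ‖) {m : ℤ} {x : ℕ → ℂ}
    (hx : ∀ k : ℕ, (p (m + k + 1) + ζ) * x (k + 2)
      - (p (m + k) + p (m + k + 1) + υ (m + k + 1)) * x (k + 1) + (p (m + k) - ζ) * x k = 0)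
    (n : ℕ) :
    stairEnergy K p ζ m x n ≤ stairEnergy K p ζ m x 0
      * Real.exp (K ^ (m + n) / (c * (K - 1)) + ∑' i : ℤ, ‖υ i‖ * K ^ i.natAbs) := by
  have hK0 : 0 < K := by linarith
  have hE0 : 0 ≤ stairEnergy K p ζ m x 0 :=
    (norm_nonneg _).trans (norm_le_stairEnergy hK p ζ m x 0)
  have hind : ∀ n : ℕ, stairEnergy K p ζ m x n ≤ stairEnergy K p ζ m x 0
      * Real.exp (K ^ (m + n) / (c * (K - 1))
        + ∑ k ∈ Finset.range n, ‖υ (m + k + 1)‖ * K ^ (m + k + 1).natAbs) := by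
    intro n
    induction n with
    | zero =>
      refine le_mul_of_one_le_right hE0 (Real.one_le_exp ?_)
      simp only [Finset.range_zero, Finset.sum_empty, add_zero]
      exact div_nonneg (zpow_nonneg hK0.le _) (mul_nonneg hc.le (by linarith))
    | succ n ih =>
      refine (stairEnergy_succ_le hK hc hcp hP hx n).trans ?_
      refine (mul_le_mul_of_nonneg_right ih (Real.exp_pos _).le).trans (le_of_eq ?_)
      rw [mul_assoc, ← Real.exp_add, Finset.sum_range_succ]
      congr 2
      have h1 : K ^ (m + ((n + 1 : ℕ) : ℤ)) = K ^ (m + (n : ℤ)) * K := by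
        rw [← zpow_add_one₀ hK0.ne']
        congr 1
        push_cast
        ring
      rw [h1]
      have h2 : K - 1 ≠ 0 := by linarith
      field_simp
      ring
  refine (hind n).trans (mul_le_mul_of_nonneg_left (Real.exp_le_exp.2 ?_) hE0)
  refine add_le_add le_rfl ?_
  have hinj : Function.Injective fun k : ℕ => m + (k : ℤ) + 1 := fun a b h => by
    simp only at h; omega
  have h1 := hs.sum_le_tsum ((Finset.range n).map ⟨_, hinj⟩)
    (fun i _ => mul_nonneg (norm_nonneg _) (pow_nonneg hK0.le _))
  simpa [Finset.sum_map] using h1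

/-- The solution of the staircase recurrence with the values `1`, `1` at the positions `m`,
`m + 1`. These approximate the Jost solution as `m → -∞`. -/
noncomputable def stairApprox (p υ : ℤ → ℂ) (ζ : ℂ) (m : ℤ) : ℕ → ℂ
  | 0 => 1
  | 1 => 1
  | k + 2 => ((p (m + k) + p (m + k + 1) + υ (m + k + 1)) * stairApprox p υ ζ m (k + 1)
      - (p (m + k) - ζ) * stairApprox p υ ζ m k) / (p (m + k + 1) + ζ)

theorem stairApprox_rec {p υ : ℤ → ℂ} {ζ : ℂ} (hp : ∀ i, p i + ζ ≠ 0) (m : ℤ) (k : ℕ) :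
    (p (m + k + 1) + ζ) * stairApprox p υ ζ m (k + 2)
      - (p (m + k) + p (m + k + 1) + υ (m + k + 1)) * stairApprox p υ ζ m (k + 1)
      + (p (m + k) - ζ) * stairApprox p υ ζ m k = 0 := by
  rw [stairApprox, mul_div_cancel₀ _ (hp _)]
  ring

theorem norm_stairApprox_le {K : ℝ} (hK : 1 < K) {p υ : ℤ → ℂ}
    (hs : Summable fun i : ℤ => ‖υ i‖ * K ^ i.natAbs) {ζ : ℂ} {c : ℝ} (hc : 0 < c)
    (hcp : ∀ i, c ≤ ‖p i + ζ‖) (hP : ∀ i, ‖p i - ζ‖ ≤ K * ‖p i + ζ‖) (m : ℤ) (n : ℕ) :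
    ‖stairApprox p υ ζ m n‖
      ≤ Real.exp (K ^ (m + n) / (c * (K - 1)) + ∑' i : ℤ, ‖υ i‖ * K ^ i.natAbs) := by
  have h := stairEnergy_le hK hs hc hcp hP
    (stairApprox_rec (υ := υ) (fun i => norm_pos_iff.1 (hc.trans_le (hcp i))) m) n
  have h0 : stairEnergy K p ζ m (stairApprox p υ ζ m) 0 = 1 := by
    simp [stairEnergy, stairApprox]
  rw [h0, one_mul] at h
  exact (norm_le_stairEnergy hK p ζ m _ n).trans h

/-- A solution with the boundary behaviour `1 + o(K ^ (-|i|))` is the limit of the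
approximations. -/
theorem tendsto_stairApprox {K : ℝ} (hK : 1 < K) {p υ : ℤ → ℂ}
    (hs : Summable fun i : ℤ => ‖υ i‖ * K ^ i.natAbs) (hfin : (range p).Finite) {ζ : ℂ} {c : ℝ}
    (hc : 0 < c) (hcp : ∀ i, c ≤ ‖p i + ζ‖) (hP : ∀ i, ‖p i - ζ‖ ≤ K * ‖p i + ζ‖) {g : ℤ → ℂ}
    (hg : ∀ i, (p (i + 1) + ζ) * g (i + 2) - (p i + p (i + 1) + υ (i + 1)) * g (i + 1)
      + (p i - ζ) * g i = 0)
    (hbd : Tendsto (fun i : ℤ => (g i - 1) * (K : ℂ) ^ i.natAbs) atBot (𝓝 0)) (i : ℤ) :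
    Tendsto (fun n : ℕ => stairApprox p υ ζ (i - n) n) atTop (𝓝 (g i)) := by
  have hK0 : 0 < K := by linarith
  obtain ⟨B, hB⟩ := hfin.isBounded.exists_norm_le
  have hpB : ∀ j, ‖p j + ζ‖ ≤ B + ‖ζ‖ := fun j =>
    (norm_add_le _ _).trans (add_le_add (hB _ (mem_range_self j)) le_rfl)
  -- the energy of the difference at its starting position
  set S : ℤ → ℝ := fun m => ‖g m - 1‖ + K ^ (-m) * ‖(p m + ζ) * (g (m + 1) - g m)‖ with hS
  have hbdn : Tendsto (fun m : ℤ => ‖g m - 1‖ * K ^ m.natAbs) atBot (𝓝 0) := by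
    have h := hbd.norm
    rw [norm_zero] at h
    refine h.congr fun m => ?_
    rw [norm_mul, norm_pow, Complex.norm_real, Real.norm_of_nonneg hK0.le]
  have hbdn1 : Tendsto (fun m : ℤ => ‖g (m + 1) - 1‖ * K ^ (m + 1).natAbs) atBot (𝓝 0) :=
    hbdn.comp (tendsto_atBot_add_const_right _ 1 tendsto_id)
  have hS0 : Tendsto S atBot (𝓝 0) := by
    have hmaj : Tendsto (fun m : ℤ => ‖g m - 1‖ * K ^ m.natAbs + (B + ‖ζ‖) *
        (K * (‖g (m + 1) - 1‖ * K ^ (m + 1).natAbs) + ‖g m - 1‖ * K ^ m.natAbs))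
        atBot (𝓝 0) := by
      have h := hbdn.add (((hbdn1.const_mul K).add hbdn).const_mul (B + ‖ζ‖))
      simpa using h
    refine squeeze_zero' (Eventually.of_forall fun m =>
      add_nonneg (norm_nonneg _) (mul_nonneg (zpow_nonneg hK0.le _) (norm_nonneg _))) ?_ hmaj
    filter_upwards [eventually_le_atBot (-1 : ℤ)] with m hm
    have h1 : K ^ (-m) = K ^ m.natAbs := by
      rw [← zpow_natCast]; congr 1; omega
    have h2 : K ^ (-m) = K * K ^ (m + 1).natAbs := by
      rw [← pow_succ', ← zpow_natCast]; congr 1; omega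
    refine add_le_add ?_ ?_
    · refine le_mul_of_one_le_right (norm_nonneg _) (one_le_pow₀ hK.le)
    · rw [norm_mul]
      calc K ^ (-m) * (‖p m + ζ‖ * ‖g (m + 1) - g m‖)
          ≤ K ^ (-m) * ((B + ‖ζ‖) * (‖g (m + 1) - 1‖ + ‖g m - 1‖)) := by
            refine mul_le_mul_of_nonneg_left ?_ (zpow_nonneg hK0.le _)
            refine mul_le_mul (hpB m) ?_ (norm_nonneg _) ((norm_nonneg _).trans (hpB m))
            have := norm_sub_le (g (m + 1) - 1) (g m - 1)
            simpa using this
        _ = (B + ‖ζ‖) * (K ^ (-m) * ‖g (m + 1) - 1‖ + K ^ (-m) * ‖g m - 1‖) := by ring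
        _ = _ := by
            congr 2
            · rw [h2]; ring
            · rw [h1]; ring
  have hpne : ∀ i, p i + ζ ≠ 0 := fun i => norm_pos_iff.1 (hc.trans_le (hcp i))
  set C := Real.exp (K ^ i / (c * (K - 1)) + ∑' i : ℤ, ‖υ i‖ * K ^ i.natAbs) with hC
  have hest : ∀ n : ℕ, ‖stairApprox p υ ζ (i - n) n - g i‖ ≤ S (i - n) * C := by
    intro n
    set m := i - (n : ℤ) with hm
    have hx : ∀ k : ℕ, (p (m + k + 1) + ζ)
          * (fun k : ℕ => g (m + k) - stairApprox p υ ζ m k) (k + 2)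
        - (p (m + k) + p (m + k + 1) + υ (m + k + 1))
          * (fun k : ℕ => g (m + k) - stairApprox p υ ζ m k) (k + 1)
        + (p (m + k) - ζ) * (fun k : ℕ => g (m + k) - stairApprox p υ ζ m k) k = 0 := by
      intro k
      have h1 := stairApprox_rec (υ := υ) hpne m k
      have h2 := hg (m + k)
      simp only
      push_cast
      rw [← add_assoc, ← add_assoc]
      linear_combination h2 - h1
    have h := stairEnergy_le hK hs hc hcp hP
      (x := fun k : ℕ => g (m + k) - stairApprox p υ ζ m k) hx n
    have hmn : m + (n : ℤ) = i := by omega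
    have h3 := (norm_le_stairEnergy hK p ζ m
      (fun k : ℕ => g (m + k) - stairApprox p υ ζ m k) n).trans h
    simp only [hmn] at h3
    rw [norm_sub_rev]
    refine h3.trans (le_of_eq ?_)
    simp [stairEnergy, stairApprox, hS, hC]
  rw [tendsto_iff_norm_sub_tendsto_zero]
  have hsub : Tendsto (fun n : ℕ => i - (n : ℤ)) atTop atBot :=
    tendsto_atBot.2 fun b => by
      filter_upwards [eventually_ge_atTop (i - b).toNat] with n hn
      omega
  refine squeeze_zero (fun n => norm_nonneg _) hest ?_
  simpa using (hS0.comp hsub).mul_const C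

namespace ClosedContour

variable {L : ClosedContour}

theorem exists_dist_bound {s t : Set ℂ} (hs : IsCompact s) (ht : t.Finite) (hst : Disjoint s t) :
    ∃ c > 0, ∀ σ ∈ s, ∀ τ ∈ t, c ≤ ‖τ - σ‖ := by
  obtain ⟨c, hc, h⟩ := (hs.prod ht.isCompact).exists_forall_le' (f := fun x : ℂ × ℂ => ‖x.2 - x.1‖)
    (a := 0) (by fun_prop) (fun x hx => norm_pos_iff.2 (sub_ne_zero.2 fun h =>
      disjoint_left.1 hst hx.1 (h ▸ hx.2)))
  exact ⟨c, hc, fun σ hσ τ hτ => h (σ, τ) ⟨hσ, hτ⟩⟩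

/-- The approximations are rational functions with poles inside the contour. -/
theorem isExteriorCauchy_stairApprox (hL : L.PositivelyOriented) {p : ℤ → ℂ} (υ : ℤ → ℂ)
    (hin : ∀ i, p i ∈ L.inside) (m : ℤ) (n : ℕ) :
    L.IsExteriorCauchy (fun σ => stairApprox p υ (-σ) m n) 1 := by
  induction n using Nat.twoStepInduction with
  | zero => exact .const hL 1
  | one => exact .const hL 1
  | more k h0 h1 =>
    set P := p (m + k + 1) with hP
    have hne : ∀ σ ∈ L.outside ∪ L.trace, P + -σ ≠ 0 := by
      intro σ hσ h
      have h2 : σ = P := by linear_combination -h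
      rw [h2] at hσ
      rcases hσ with hσ | hσ
      · exact notMem_outside_of_mem_inside (hin _) hσ
      · exact (hin _).1 hσ
    have hcont : ContinuousOn (fun σ => stairApprox p υ (-σ) m (k + 2)) L.trace := by
      simp only [stairApprox]
      refine ((continuousOn_const.mul h1.cont).sub
        (ContinuousOn.mul (by fun_prop) h0.cont)).div (by fun_prop)
        fun σ hσ => hne σ (Or.inr hσ)
    have hk : L.IsExteriorCauchy
        (fun σ => stairApprox p υ (-σ) m (k + 2) - stairApprox p υ (-σ) m k) 0 := by
      refine ((h1.const_mul (-(p (m + k) + P + υ (m + k + 1)))).add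
        (h0.const_mul (p (m + k) + P))).of_sub_mul_eq (hin (m + k + 1)).1 (hcont.sub h0.cont) ?_
        fun h => absurd h (notMem_outside_of_mem_inside (hin _))
      intro σ hσ
      have h2 := hne σ hσ
      rw [stairApprox]
      rw [← hP]
      field_simp
      ring
    have h := hk.add h0
    rw [zero_add] at h
    exact h.congr fun σ _ => by ring

/-- The Jost solution on a staircase satisfies the exterior Cauchy formula in `-ζ`. -/
theorem isExteriorCauchy_stair (hL : L.PositivelyOriented) {K : ℝ} (hK : 1 < K) {p υ : ℤ → ℂ}
    (hs : Summable fun i : ℤ => ‖υ i‖ * K ^ i.natAbs) (hfin : (range p).Finite)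
    (hin : ∀ i, p i ∈ L.inside)
    (hP : ∀ σ ∈ L.outside ∪ L.trace, ∀ i, ‖p i + σ‖ ≤ K * ‖p i - σ‖) {g : ℤ → ℂ → ℂ}
    (hg : ∀ σ ∈ L.outside ∪ L.trace, ∀ i, (p (i + 1) - σ) * g (i + 2) σ
      - (p i + p (i + 1) + υ (i + 1)) * g (i + 1) σ + (p i + σ) * g i σ = 0)
    (hbd : ∀ σ ∈ L.outside ∪ L.trace,
      Tendsto (fun i : ℤ => (g i σ - 1) * (K : ℂ) ^ i.natAbs) atBot (𝓝 0))
    (hcont : ∀ i, ContinuousOn (g i) L.trace) (i : ℤ) : L.IsExteriorCauchy (g i) 1 := by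
  have hdisj : ∀ σ ∈ L.outside ∪ L.trace, σ ∉ range p := by
    rintro σ hσ ⟨j, rfl⟩
    rcases hσ with hσ | hσ
    · exact notMem_outside_of_mem_inside (hin _) hσ
    · exact (hin _).1 hσ
  have hP' : ∀ σ ∈ L.outside ∪ L.trace, ∀ i, ‖p i - -σ‖ ≤ K * ‖p i + -σ‖ := by
    intro σ hσ i
    rw [sub_neg_eq_add, ← sub_eq_add_neg]
    exact hP σ hσ i
  obtain ⟨c, hc, hcb⟩ := exists_dist_bound L.isCompact_trace hfin
    (disjoint_left.2 fun σ hσ => hdisj σ (Or.inr hσ))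
  refine IsExteriorCauchy.of_tendsto (G := fun n σ => stairApprox p υ (-σ) (i - n) n)
    (fun n => isExteriorCauchy_stairApprox hL υ hin _ n)
    (C := Real.exp (K ^ i / (c * (K - 1)) + ∑' i : ℤ, ‖υ i‖ * K ^ i.natAbs)) ?_ (hcont i) ?_
  · intro n σ hσ
    have h := norm_stairApprox_le hK hs hc (ζ := -σ)
      (fun j => by rw [← sub_eq_add_neg]; exact hcb σ hσ _ (mem_range_self j))
      (hP' σ (Or.inr hσ)) (i - n) n
    rwa [sub_add_cancel] at h
  · intro σ hσ
    obtain ⟨c, hc, hcb⟩ := exists_dist_bound (isCompact_singleton (x := σ)) hfin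
      (disjoint_singleton_left.2 (hdisj σ hσ))
    refine tendsto_stairApprox hK hs hfin hc
      (fun j => by rw [← sub_eq_add_neg]; exact hcb σ rfl _ (mem_range_self j))
      (hP' σ hσ) (g := fun j => g j σ) ?_ (hbd σ hσ) i
    intro j
    rw [sub_neg_eq_add, ← sub_eq_add_neg]
    exact hg σ hσ j

end ClosedContour

/-! ### Propagation from a staircase to the lattice -/

/-- Every lattice point is reached from a staircase by unit translations of the whole staircase. -/
theorem Staircase.induction {N : ℕ} (Γ : Staircase N) {Q : (Fin N → ℤ) → Prop}
    (base : ∀ i, Q (Γ.pt i))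
    (plus : ∀ m s, (∀ i, Q (Γ.pt i + m)) → ∀ i, Q (Γ.pt i + m + Pi.single s 1))
    (minus : ∀ m s, (∀ i, Q (Γ.pt i + m)) → ∀ i, Q (Γ.pt i + m - Pi.single s 1))
    (n : Fin N → ℤ) : Q n := by
  have key : ∀ (s : Fin N) (k : ℤ) (m : Fin N → ℤ), (∀ i, Q (Γ.pt i + m)) →
      ∀ i, Q (Γ.pt i + (m + Pi.single s k)) := by
    intro s k m hm
    induction k using Int.induction_on with
    | zero => simpa using hm
    | succ k ih =>
      intro i
      have h := plus _ s ih i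
      rwa [add_assoc, add_assoc, ← Pi.single_add] at h
    | pred k ih =>
      intro i
      have h := minus _ s ih i
      rwa [add_sub_assoc, add_sub_assoc, ← Pi.single_sub] at h
  have hsum : ∀ (T : Finset (Fin N)) (f : Fin N → ℤ) (i : ℤ),
      Q (Γ.pt i + ∑ s ∈ T, Pi.single s (f s)) := by
    intro T f
    induction T using Finset.induction_on with
    | empty => simpa using base
    | insert s T hs ih =>
      rw [Finset.sum_insert hs]
      intro i
      rw [add_comm (Pi.single (M := fun _ => ℤ) s (f s))]
      revert i
      exact key s (f s) _ ih
  have h := hsum Finset.univ (n - Γ.pt 0) 0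
  rwa [Finset.univ_sum_single, add_sub_cancel] at h

namespace ClosedContour

variable {L : ClosedContour}

/-- The second-order lattice equation expresses a solution on a translated staircase through the
solution on the staircase itself, up to division by a linear factor in `ζ`. This carries the
exterior Cauchy formula from the staircase to the whole lattice. -/
theorem isExteriorCauchy_lattice {N : ℕ} (Γ : Staircase N) {p : Fin N → ℂ}
    {V : (Fin N → ℤ) → Fin N → Fin N → ℂ} {G : (Fin N → ℤ) → ℂ → ℂ} {X : Set ℂ}
    (hX : ∀ σ ∈ L.outside ∪ L.trace, -σ ∉ X)
    (hpL : ∀ r, p r ∉ L.trace ∧ -p r ∉ L.trace)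
    (hG : ∀ n r s, ∀ ζ ∉ X, (p s + ζ) * G (n + Pi.single r 1 + Pi.single s 1) ζ
      - V n r s * G (n + Pi.single r 1) ζ + (p r - ζ) * G n ζ = 0)
    (hcont : ∀ n, ContinuousOn (G n) Xᶜ)
    (hbase : ∀ i, L.IsExteriorCauchy (fun σ => G (Γ.pt i) (-σ)) 1) (n : Fin N → ℤ) :
    L.IsExteriorCauchy (fun σ => G n (-σ)) 1 := by
  have hc : ∀ n, ContinuousOn (fun σ => G n (-σ)) (L.outside ∪ L.trace) := fun n =>
    (hcont n).comp continuousOn_neg fun σ hσ => hX σ hσ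
  have hca : ∀ n, ∀ a ∈ L.outside, ContinuousAt (fun σ => G n (-σ)) a := fun n a ha =>
    ((hc n).mono subset_union_left).continuousAt (isOpen_outside.mem_nhds ha)
  have hct : ∀ n, ContinuousOn (fun σ => G n (-σ)) L.trace := fun n =>
    (hc n).mono subset_union_right
  refine Γ.induction (Q := fun n => L.IsExteriorCauchy (fun σ => G n (-σ)) 1) hbase ?_ ?_ n
  · intro m s hm i
    obtain ⟨j, rfl⟩ : ∃ j, i = j + 1 := ⟨i - 1, by ring⟩
    have hpt : Γ.pt j + m + Pi.single (Γ.dir j) 1 = Γ.pt (j + 1) + m := by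
      rw [Γ.step]; abel
    have hk : L.IsExteriorCauchy (fun σ => G (Γ.pt (j + 1) + m + Pi.single s 1) (-σ)
        - G (Γ.pt j + m) (-σ)) 0 := by
      refine (((hm (j + 1)).const_mul (-V (Γ.pt j + m) (Γ.dir j) s)).add
        ((hm j).const_mul (p (Γ.dir j) + p s))).of_sub_mul_eq (hpL s).1
        ((hct _).sub (hct _)) ?_ fun ha => (hca _ _ ha).sub (hca _ _ ha)
      intro σ hσ
      have h := hG (Γ.pt j + m) (Γ.dir j) s (-σ) (hX σ hσ)
      rw [hpt] at h
      linear_combination -h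
    have h := hk.add (hm j)
    rw [zero_add] at h
    exact h.congr fun σ _ => by ring
  · intro m s hm i
    have hpt : Γ.pt i + m - Pi.single s 1 + Pi.single s 1 = Γ.pt i + m := by abel
    have hpt2 : Γ.pt i + m + Pi.single (Γ.dir i) 1 = Γ.pt (i + 1) + m := by
      rw [Γ.step]; abel
    have hk : L.IsExteriorCauchy (fun σ => G (Γ.pt i + m - Pi.single s 1) (-σ)
        - G (Γ.pt (i + 1) + m) (-σ)) 0 := by
      refine (((hm i).const_mul (V (Γ.pt i + m - Pi.single s 1) s (Γ.dir i))).add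
        ((hm (i + 1)).const_mul (-(p (Γ.dir i) + p s)))).of_sub_mul_eq (hpL s).2
        ((hct _).sub (hct _)) ?_ fun ha => (hca _ _ ha).sub (hca _ _ ha)
      intro σ hσ
      have h := hG (Γ.pt i + m - Pi.single s 1) s (Γ.dir i) (-σ) (hX σ hσ)
      rw [hpt, hpt2] at h
      linear_combination h
    have h := hk.add (hm (i + 1))
    rw [zero_add] at h
    exact h.congr fun σ _ => by ring

end ClosedContour

/-! ### Solutions of the linear lattice equation -/

/-- `k` solves the scalar second-order linear equation on `ℤ^N` with parameter `ζ`, for all pairs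
of directions. -/
def SolvesLattice {N : ℕ} (p : Fin N → ℂ) (V : (Fin N → ℤ) → Fin N → Fin N → ℂ) (ζ : ℂ)
    (k : (Fin N → ℤ) → ℂ) : Prop :=
  ∀ n r s, (p s + ζ) * k (n + Pi.single r 1 + Pi.single s 1)
    - V n r s * k (n + Pi.single r 1) + (p r - ζ) * k n = 0

namespace SolvesLattice

variable {N : ℕ} {p : Fin N → ℂ} {V : (Fin N → ℤ) → Fin N → Fin N → ℂ} {ζ : ℂ}
  {k l : (Fin N → ℤ) → ℂ}

theorem sub (hk : SolvesLattice p V ζ k) (hl : SolvesLattice p V ζ l) :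
    SolvesLattice p V ζ (fun n => k n - l n) := by
  intro n r s
  linear_combination hk n r s - hl n r s

theorem const_mul (hk : SolvesLattice p V ζ k) (c : ℂ) :
    SolvesLattice p V ζ (fun n => c * k n) := by
  intro n r s
  linear_combination c * hk n r s

end SolvesLattice

theorem planeWave_add_single {N : ℕ} {p : Fin N → ℂ} {ζ : ℂ} (h₁ : ∀ r, p r + ζ ≠ 0)
    (h₂ : ∀ r, p r - ζ ≠ 0) (n : Fin N → ℤ) (r : Fin N) :
    planeWave p (n + Pi.single r 1) ζ = planeWave p n ζ * ((p r + ζ) / (p r - ζ)) := by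
  classical
  unfold planeWave
  simp only [Pi.add_apply, zpow_add₀ (div_ne_zero (h₁ _) (h₂ _)), Finset.prod_mul_distrib]
  congr 1
  rw [Finset.prod_eq_single r]
  · simp
  · intro s _ hs
    simp [hs]
  · simp

theorem planeWave_ne_zero {N : ℕ} {p : Fin N → ℂ} {ζ : ℂ} (h₁ : ∀ r, p r + ζ ≠ 0)
    (h₂ : ∀ r, p r - ζ ≠ 0) (n : Fin N → ℤ) : planeWave p n ζ ≠ 0 :=
  Finset.prod_ne_zero_iff.2 fun r _ => zpow_ne_zero _ (div_ne_zero (h₁ r) (h₂ r))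

theorem continuousOn_planeWave {N : ℕ} {p : Fin N → ℂ} {s : Set ℂ}
    (h₁ : ∀ ζ ∈ s, ∀ r, p r + ζ ≠ 0) (h₂ : ∀ ζ ∈ s, ∀ r, p r - ζ ≠ 0) (n : Fin N → ℤ) :
    ContinuousOn (planeWave p n) s := by
  unfold planeWave
  refine continuousOn_finsetProd _ fun r _ => ?_
  refine ContinuousOn.zpow₀ ?_ _ fun ζ hζ => Or.inl (div_ne_zero (h₁ ζ hζ r) (h₂ ζ hζ r))
  exact (by fun_prop : ContinuousOn (fun ζ => p r + ζ) s).div (by fun_prop) fun ζ hζ => h₂ ζ hζ r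

namespace SolvesLattice

variable {N : ℕ} {p : Fin N → ℂ} {V : (Fin N → ℤ) → Fin N → Fin N → ℂ} {ζ : ℂ}
  {k l : (Fin N → ℤ) → ℂ}

/-- Multiplication by the plane wave changes the sign of the spectral parameter. -/
theorem planeWave_mul (hk : SolvesLattice p V ζ k) (h₁ : ∀ r, p r + ζ ≠ 0)
    (h₂ : ∀ r, p r - ζ ≠ 0) : SolvesLattice p V (-ζ) (fun n => planeWave p n ζ * k n) := by
  intro n r s
  simp only [planeWave_add_single h₁ h₂]
  have hr := h₂ r
  have hs := h₂ s
  have hs' : p s + -ζ ≠ 0 := by rwa [← sub_eq_add_neg]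
  have h := hk n r s
  have hmul : (p s + -ζ) * (planeWave p n ζ * ((p r + ζ) / (p r - ζ)) * ((p s + ζ) / (p s - ζ))
        * k (n + Pi.single r 1 + Pi.single s 1))
      = planeWave p n ζ * ((p r + ζ) / (p r - ζ))
        * ((p s + ζ) * k (n + Pi.single r 1 + Pi.single s 1)) := by
    rw [← sub_eq_add_neg]
    field_simp
  have hmul2 : (p r - -ζ) * (planeWave p n ζ * k n)
      = planeWave p n ζ * ((p r + ζ) / (p r - ζ)) * ((p r - ζ) * k n) := by
    field_simp
    ring
  rw [hmul, hmul2]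
  linear_combination (planeWave p n ζ * ((p r + ζ) / (p r - ζ))) * h

/-- A solution is determined by its values at two consecutive points of a staircase. -/
theorem eq_zero (hk : SolvesLattice p V ζ k) (h₁ : ∀ r, p r + ζ ≠ 0) (h₂ : ∀ r, p r - ζ ≠ 0)
    (Γ : Staircase N) (h0 : k (Γ.pt 0) = 0) (h1 : k (Γ.pt 1) = 0) (n : Fin N → ℤ) : k n = 0 := by
  have hstair : ∀ i, k (Γ.pt i) = 0 ∧ k (Γ.pt (i + 1)) = 0 := by
    intro i
    have hrec : ∀ i, (p (Γ.dir (i + 1)) + ζ) * k (Γ.pt (i + 1 + 1))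
        - V (Γ.pt i) (Γ.dir i) (Γ.dir (i + 1)) * k (Γ.pt (i + 1))
        + (p (Γ.dir i) - ζ) * k (Γ.pt i) = 0 := by
      intro i
      have h := hk (Γ.pt i) (Γ.dir i) (Γ.dir (i + 1))
      rwa [← Γ.step, ← Γ.step] at h
    induction i using Int.induction_on with
    | zero => exact ⟨h0, by simpa using h1⟩
    | succ i ih =>
      refine ⟨ih.2, ?_⟩
      have h := hrec i
      rw [ih.1, ih.2, mul_zero, mul_zero, sub_zero, add_zero] at h
      exact (mul_eq_zero.1 h).resolve_left (h₁ _)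
    | pred i ih =>
      have h := hrec (-(i : ℤ) - 1)
      rw [sub_add_cancel, ih.1, ih.2, mul_zero, mul_zero, sub_zero, zero_add] at h
      exact ⟨(mul_eq_zero.1 h).resolve_left (h₂ _), by rw [sub_add_cancel]; exact ih.1⟩
  refine Γ.induction (Q := fun n => k n = 0) (fun i => (hstair i).1) ?_ ?_ n
  · intro m s hm i
    obtain ⟨j, rfl⟩ : ∃ j, i = j + 1 := ⟨i - 1, by ring⟩
    have hpt : Γ.pt j + m + Pi.single (Γ.dir j) 1 = Γ.pt (j + 1) + m := by
      rw [Γ.step]; abel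
    have h := hk (Γ.pt j + m) (Γ.dir j) s
    rw [hpt, hm, hm, mul_zero, mul_zero, sub_zero, add_zero] at h
    exact (mul_eq_zero.1 h).resolve_left (h₁ _)
  · intro m s hm i
    have hpt : Γ.pt i + m - Pi.single s 1 + Pi.single s 1 = Γ.pt i + m := by abel
    have hpt2 : Γ.pt i + m + Pi.single (Γ.dir i) 1 = Γ.pt (i + 1) + m := by
      rw [Γ.step]; abel
    have h := hk (Γ.pt i + m - Pi.single s 1) s (Γ.dir i)
    rw [hpt, hpt2, hm, hm, mul_zero, mul_zero, sub_zero, zero_add] at h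
    exact (mul_eq_zero.1 h).resolve_left (h₂ _)

end SolvesLattice

/-- The Wronskian, in the direction `r` at the point `n`, of a solution `h` with parameter `-ζ` and
a solution `g` with parameter `ζ`. -/
def latticeWronskian {N : ℕ} (p : Fin N → ℂ) (ζ : ℂ) (h g : (Fin N → ℤ) → ℂ) (n : Fin N → ℤ)
    (r : Fin N) : ℂ :=
  (p r + ζ) * h n * g (n + Pi.single r 1) - (p r - ζ) * h (n + Pi.single r 1) * g n

theorem latticeWronskian_shift {N : ℕ} {p : Fin N → ℂ} {V : (Fin N → ℤ) → Fin N → Fin N → ℂ}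
    {ζ : ℂ} {h g : (Fin N → ℤ) → ℂ} (hh : SolvesLattice p V (-ζ) h) (hg : SolvesLattice p V ζ g)
    (n : Fin N → ℤ) (r s : Fin N) :
    latticeWronskian p ζ h g (n + Pi.single r 1) s = latticeWronskian p ζ h g n r := by
  unfold latticeWronskian
  linear_combination h (n + Pi.single r 1) * hg n r s - g (n + Pi.single r 1) * hh n r s

/-- The Wronskian depends neither on the point nor on the direction. -/
theorem latticeWronskian_eq {N : ℕ} {p : Fin N → ℂ} {V : (Fin N → ℤ) → Fin N → Fin N → ℂ}
    {ζ : ℂ} {h g : (Fin N → ℤ) → ℂ} (hh : SolvesLattice p V (-ζ) h) (hg : SolvesLattice p V ζ g)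
    (Γ : Staircase N) (n : Fin N → ℤ) (r : Fin N) :
    latticeWronskian p ζ h g n r = latticeWronskian p ζ h g (Γ.pt 0) (Γ.dir 0) := by
  have hshift := latticeWronskian_shift hh hg
  have hdir : ∀ n r s, latticeWronskian p ζ h g n r = latticeWronskian p ζ h g n s := by
    intro n r s
    have h1 := hshift (n - Pi.single r 1) r r
    have h2 := hshift (n - Pi.single r 1) r s
    rw [sub_add_cancel] at h1 h2
    rw [h1, h2]
  have hplus : ∀ n r, latticeWronskian p ζ h g (n + Pi.single r 1) (Γ.dir 0)
      = latticeWronskian p ζ h g n (Γ.dir 0) := fun n r => by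
    rw [hshift, hdir n r (Γ.dir 0)]
  rw [hdir n r (Γ.dir 0)]
  refine Γ.induction (Q := fun n => latticeWronskian p ζ h g n (Γ.dir 0)
    = latticeWronskian p ζ h g (Γ.pt 0) (Γ.dir 0)) ?_ ?_ ?_ n
  · intro i
    induction i using Int.induction_on with
    | zero => rfl
    | succ i ih => rw [Γ.step, hplus, ih]
    | pred i ih =>
      have h := Γ.step (-(i : ℤ) - 1)
      rw [sub_add_cancel] at h
      rw [← ih, h, hplus]
  · intro m s hm i
    rw [hplus, hm]
  · intro m s hm i
    rw [← hm i, ← hplus (Γ.pt i + m - Pi.single s 1) s, sub_add_cancel]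

theorem latticeWronskian_eq_two_mul {N : ℕ} {p : Fin N → ℂ}
    {V : (Fin N → ℤ) → Fin N → Fin N → ℂ} {ζ : ℂ} {h g : (Fin N → ℤ) → ℂ}
    (hh : SolvesLattice p V (-ζ) h) (hg : SolvesLattice p V ζ g) (Γ : Staircase N)
    (hlim : Tendsto (fun i => h (Γ.pt i)) atBot (𝓝 1))
    (glim : Tendsto (fun i => g (Γ.pt i)) atBot (𝓝 1)) (n : Fin N → ℤ) (r : Fin N) :
    latticeWronskian p ζ h g n r = 2 * ζ := by
  rw [latticeWronskian_eq hh hg Γ]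
  have hshift : Tendsto (fun i : ℤ => i + 1) atBot atBot :=
    tendsto_atBot_add_const_right _ 1 tendsto_id
  have hX : Tendsto (fun i => h (Γ.pt i) * g (Γ.pt (i + 1))) atBot (𝓝 1) := by
    simpa using hlim.mul (glim.comp hshift)
  have hY : Tendsto (fun i => h (Γ.pt (i + 1)) * g (Γ.pt i)) atBot (𝓝 1) := by
    simpa using (hlim.comp hshift).mul glim
  obtain ⟨B, hB⟩ := (finite_range p).isBounded.exists_norm_le
  have hp0 : Tendsto (fun i => p (Γ.dir i) * (h (Γ.pt i) * g (Γ.pt (i + 1))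
      - h (Γ.pt (i + 1)) * g (Γ.pt i))) atBot (𝓝 0) := by
    have h0 : Tendsto (fun i => B * ‖h (Γ.pt i) * g (Γ.pt (i + 1))
        - h (Γ.pt (i + 1)) * g (Γ.pt i)‖) atBot (𝓝 0) := by
      simpa using (hX.sub hY).norm.const_mul B
    refine squeeze_zero_norm (fun i => ?_) h0
    rw [norm_mul]
    exact mul_le_mul_of_nonneg_right (hB _ (mem_range_self _)) (norm_nonneg _)
  have hsum := hp0.add ((hX.add hY).const_mul ζ)
  refine tendsto_nhds_unique (tendsto_const_nhds (f := (atBot : Filter ℤ))) ?_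
  have h2 : (2 : ℂ) * ζ = 0 + ζ * (1 + 1) := by ring
  rw [h2]
  refine hsum.congr fun i => ?_
  rw [← latticeWronskian_eq hh hg Γ (Γ.pt i) (Γ.dir i)]
  unfold latticeWronskian
  rw [← Γ.step]
  ring

/-! ### The Jost functions and the spectral functions -/

/-- The staircase traversed backwards, reflected in the origin. -/
def Staircase.reverse {N : ℕ} (Γ : Staircase N) : Staircase N where
  dir j := Γ.dir (-j - 1)
  pt j := -Γ.pt (-j)
  step j := by
    have h := Γ.step (-j - 1)
    rw [sub_add_cancel] at h
    rw [h, neg_add (a := j), ← sub_eq_add_neg]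
    abel

namespace Q3Solution

variable {N : ℕ} {S : Q3Solution N} {Γ : Staircase N} {K : ℝ} {L : ClosedContour}
  {Lam Ups : (Fin N → ℤ) → ℂ → ℂ}

/-- `K` exceeds a number and its reciprocal; both are defined because `P r ≠ 0` excludes
`p r = ± a`. -/
theorem one_lt_of_weightBound (hK : S.WeightBound Γ K) : 1 < K := by
  set q := S.p (Γ.dir 0)
  have h1 := hK 0 S.a (by simp)
  have h2 := hK 0 (-S.a) (by simp)
  have hne : (q - S.a) * (q + S.a) ≠ 0 := by
    intro h
    refine S.P_ne (Γ.dir 0) (pow_eq_zero_iff two_ne_zero |>.1 ?_)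
    rw [S.curve]
    linear_combination (q ^ 2 - S.b ^ 2) * h
  have hm : 0 < ‖q - S.a‖ := norm_pos_iff.2 (left_ne_zero_of_mul hne)
  have hp : 0 < ‖q + S.a‖ := norm_pos_iff.2 (right_ne_zero_of_mul hne)
  rw [norm_div, div_lt_iff₀ hm] at h1
  rw [sub_neg_eq_add, ← sub_eq_add_neg, norm_div, div_lt_iff₀ hp] at h2
  by_contra! hK1
  nlinarith

theorem neg_mem_regionP_iff {ζ : ℂ} : -ζ ∈ S.regionP Γ K ↔ ζ ∈ S.regionPStar Γ K := by
  simp only [regionP, regionPStar, mem_ofPred_eq, sub_neg_eq_add, ← sub_eq_add_neg]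

theorem p_mem_regionPStar (hp : ∀ i, S.p (Γ.dir i) ≠ 0) (i : ℤ) :
    S.p (Γ.dir i) ∈ S.regionPStar Γ K := by
  refine ⟨i, ?_⟩
  rw [sub_self, norm_zero, mul_zero, ← two_mul]
  exact norm_pos_iff.2 (mul_ne_zero two_ne_zero (hp i))

/-- The exceptional points off the staircase. -/
def exceptional (S : Q3Solution N) (L : ClosedContour) : Set ℂ :=
  {ζ | ∃ r, S.p r ∈ L.inside ∧ ζ = -S.p r}

theorem neg_notMem_singular (hPstar : S.regionPStar Γ K ⊆ L.inside) {σ : ℂ}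
    (hσ : σ ∈ L.outside ∪ L.trace) : -σ ∉ S.regionP Γ K ∪ S.exceptional L := by
  have hins : σ ∉ L.inside := fun h =>
    hσ.elim (ClosedContour.notMem_outside_of_mem_inside h) h.1
  rintro (h | ⟨r, hr, h⟩)
  · exact hins (hPstar (neg_mem_regionP_iff.1 h))
  · rw [neg_inj] at h
    exact hins (h ▸ hr)

theorem summable_potential (hadm : S.Admissible Γ Lam Ups K) (hK : 1 < K) :
    Summable fun i : ℤ => ‖S.potential Γ i‖ * K ^ i.natAbs := by
  refine hadm.summable.of_nonneg_of_le (fun i => ?_) fun i => ?_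
  · exact mul_nonneg (norm_nonneg _) (pow_nonneg (by linarith) _)
  · refine le_mul_of_one_le_right (mul_nonneg (norm_nonneg _) (pow_nonneg (by linarith) _)) ?_
    linarith [Nat.cast_nonneg (α := ℝ) i.natAbs]

theorem IsJost.solves_lam {E : Set ℂ} (hJ : S.IsJost Γ K E Lam Ups) {ζ : ℂ}
    (hζ : ζ ∉ S.regionP Γ K ∪ E) : SolvesLattice S.p S.coeff ζ (fun n => Lam n ζ) :=
  fun n r s => hJ.lam_lattice n r s ζ hζ

theorem IsJost.solves_ups {E : Set ℂ} (hJ : S.IsJost Γ K E Lam Ups) {ζ : ℂ}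
    (hζ : ζ ∉ S.regionP Γ K ∪ E) : SolvesLattice S.p S.coeff (-ζ) (fun n => Ups n ζ) := by
  intro n r s
  have h := hJ.ups_lattice n r s ζ hζ
  linear_combination h

theorem IsJost.tendsto_lam {E : Set ℂ} (hJ : S.IsJost Γ K E Lam Ups) {ζ : ℂ}
    (hζ : ζ ∉ S.regionP Γ K ∪ E) : Tendsto (fun i => Lam (Γ.pt i) ζ) atBot (𝓝 1) := by
  simpa using hJ.lam_translate 0 ζ hζ

theorem norm_add_le_of_notMem_regionPStar {σ : ℂ} (hσ : σ ∉ S.regionPStar Γ K) (i : ℤ) :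
    ‖S.p (Γ.dir i) + σ‖ ≤ K * ‖S.p (Γ.dir i) - σ‖ := by
  by_contra! h
  exact hσ ⟨i, h⟩

theorem isExteriorCauchy_lam (hL : L.PositivelyOriented) (hK : 1 < K)
    (hp : ∀ i, S.p (Γ.dir i) ≠ 0) (hPstar : S.regionPStar Γ K ⊆ L.inside)
    (hpL : ∀ r, S.p r ∉ L.trace ∧ -S.p r ∉ L.trace)
    (hJ : S.IsJost Γ K (S.exceptional L) Lam Ups) (hadm : S.Admissible Γ Lam Ups K)
    (n : Fin N → ℤ) : L.IsExteriorCauchy (fun σ => Lam n (-σ)) 1 := by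
  have hX : ∀ σ ∈ L.outside ∪ L.trace, -σ ∉ S.regionP Γ K ∪ S.exceptional L :=
    fun σ hσ => neg_notMem_singular hPstar hσ
  refine ClosedContour.isExteriorCauchy_lattice Γ (V := S.coeff) hX hpL
    (fun n r s ζ hζ => hJ.lam_lattice n r s ζ hζ) hJ.lam_cont ?_ n
  refine ClosedContour.isExteriorCauchy_stair hL hK (p := fun i => S.p (Γ.dir i))
    (υ := S.potential Γ) (g := fun i σ => Lam (Γ.pt i) (-σ)) (summable_potential hadm hK)
    ((finite_range S.p).subset (range_comp_subset_range Γ.dir S.p))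
    (fun i => hPstar (p_mem_regionPStar hp i)) ?_ ?_ ?_ ?_
  · exact fun σ hσ i => norm_add_le_of_notMem_regionPStar
      (fun h => hX σ hσ (Or.inl (neg_mem_regionP_iff.2 h))) i
  · intro σ hσ i
    have h := hJ.lam_stair i (-σ) fun h => hX σ hσ (Or.inl h)
    linear_combination h
  · exact fun σ hσ => hJ.lam_bdry (-σ) fun h => hX σ hσ (Or.inl h)
  · exact fun i => (hJ.lam_cont _).comp continuousOn_neg fun σ hσ => hX σ (Or.inr hσ)

/-- `n ↦ Υ(-n)` is a Jost function of the same kind as `Λ`, for the reversed staircase. -/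
theorem isExteriorCauchy_ups (hL : L.PositivelyOriented) (hK : 1 < K)
    (hp : ∀ i, S.p (Γ.dir i) ≠ 0) (hPstar : S.regionPStar Γ K ⊆ L.inside)
    (hpL : ∀ r, S.p r ∉ L.trace ∧ -S.p r ∉ L.trace)
    (hJ : S.IsJost Γ K (S.exceptional L) Lam Ups) (hadm : S.Admissible Γ Lam Ups K)
    (n : Fin N → ℤ) : L.IsExteriorCauchy (fun σ => Ups n (-σ)) 1 := by
  have hX : ∀ σ ∈ L.outside ∪ L.trace, -σ ∉ S.regionP Γ K ∪ S.exceptional L :=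
    fun σ hσ => neg_notMem_singular hPstar hσ
  have key := ClosedContour.isExteriorCauchy_lattice Γ.reverse
    (V := fun n r s => S.coeff (-(n + Pi.single r 1 + Pi.single s 1)) s r)
    (G := fun n ζ => Ups (-n) ζ) hX hpL ?_ (fun n => hJ.ups_cont (-n)) ?_ (-n)
  · simpa using key
  · intro n r s ζ hζ
    have h := hJ.ups_lattice (-(n + Pi.single r 1 + Pi.single s 1)) s r ζ hζ
    have e1 : -(n + Pi.single r 1 + Pi.single s 1) + Pi.single s 1 = -(n + Pi.single r 1) := by abel
    have e2 : -(n + Pi.single r 1) + Pi.single r 1 = -n := by abel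
    rw [e1, e2] at h
    linear_combination h
  · refine ClosedContour.isExteriorCauchy_stair hL hK (p := fun j => S.p (Γ.dir (-j - 1)))
      (υ := fun j => S.potential Γ (-j)) (g := fun j σ => Ups (-Γ.reverse.pt j) (-σ)) ?_
      ((finite_range S.p).subset (range_comp_subset_range (fun j => Γ.dir (-j - 1)) S.p))
      (fun i => hPstar (p_mem_regionPStar hp _)) ?_ ?_ ?_ ?_
    · have h := (summable_potential hadm hK).comp_injective (neg_injective (G := ℤ))
      simpa [Function.comp_def] using h
    · exact fun σ hσ i => norm_add_le_of_notMem_regionPStar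
        (fun h => hX σ hσ (Or.inl (neg_mem_regionP_iff.2 h))) _
    · intro σ hσ j
      have h := hJ.ups_stair (-j - 2) (-σ) fun h => hX σ hσ (Or.inl h)
      have e1 : -j - 2 + 1 = -j - 1 := by ring
      have e2 : -j - 2 + 2 = -j := by ring
      have e3 : -j - 1 - 1 = -j - 2 := by ring
      have e4 : -(j + 2) = -j - 2 := by ring
      have e5 : -(j + 1) = -j - 1 := by ring
      rw [e1, e2] at h
      simp only [Staircase.reverse, neg_neg, e3, e4, e5]
      linear_combination h
    · intro σ hσ
      have h := (hJ.ups_bdry (-σ) fun h => hX σ hσ (Or.inl h)).comp tendsto_neg_atBot_atTop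
      simpa [Function.comp_def, Staircase.reverse] using h
    · exact fun i => (hJ.ups_cont _).comp continuousOn_neg fun σ hσ => hX σ (Or.inr hσ)

/-- The scattering relation on the whole lattice. On the staircase it is Cramer's rule, with the
Wronskian `2ζ` of `Λ(·;-ζ)` and `Λ(·;ζ)`; both sides solve the lattice equation. -/
theorem IsJost.ups_eq {E : Set ℂ} (hJ : S.IsJost Γ K E Lam Ups) {ζ : ℂ} (hζ0 : ζ ≠ 0)
    (hζ : ζ ∉ S.regionP Γ K ∪ E) (hζ' : -ζ ∉ S.regionP Γ K ∪ E)
    (h₁ : ∀ r, S.p r + ζ ≠ 0) (h₂ : ∀ r, S.p r - ζ ≠ 0) (n : Fin N → ℤ) :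
    Ups n ζ = S.specA Γ Lam Ups ζ * Lam n (-ζ)
      + S.specB Γ Lam Ups ζ * (planeWave S.p n ζ * Lam n ζ) := by
  have hW := latticeWronskian_eq_two_mul (hJ.solves_lam hζ') (hJ.solves_lam hζ) Γ
    (hJ.tendsto_lam hζ') (hJ.tendsto_lam hζ) (Γ.pt 0) (Γ.dir 0)
  have hpt : Γ.pt 1 = Γ.pt 0 + Pi.single (Γ.dir 0) 1 := by simpa using Γ.step 0
  unfold latticeWronskian at hW
  rw [← hpt] at hW
  have hsol := ((hJ.solves_ups hζ).sub ((hJ.solves_lam hζ').const_mul (S.specA Γ Lam Ups ζ))).sub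
    (((hJ.solves_lam hζ).planeWave_mul h₁ h₂).const_mul (S.specB Γ Lam Ups ζ))
  have hρ := planeWave_ne_zero h₁ h₂ (Γ.pt 0)
  have hρ1 : planeWave S.p (Γ.pt 1) ζ
      = planeWave S.p (Γ.pt 0) ζ * ((S.p (Γ.dir 0) + ζ) / (S.p (Γ.dir 0) - ζ)) := by
    rw [hpt, planeWave_add_single h₁ h₂]
  have hd := h₂ (Γ.dir 0)
  have h := hsol.eq_zero (fun r => by rw [← sub_eq_add_neg]; exact h₂ r)
    (fun r => by rw [sub_neg_eq_add]; exact h₁ r) Γ ?_ ?_ n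
  · linear_combination h
  · simp only [specA, specB]
    field_simp
    linear_combination (-Ups (Γ.pt 0) ζ) * hW
  · simp only [specA, specB, hρ1]
    field_simp
    linear_combination (-Ups (Γ.pt 1) ζ) * hW

/-- At a zero of `A` the Jost functions are proportional. -/
theorem IsJost.exists_ups_eq {E : Set ℂ} (hJ : S.IsJost Γ K E Lam Ups) {ζ : ℂ} (hζ0 : ζ ≠ 0)
    (hζ : ζ ∉ S.regionP Γ K ∪ E) (h₁ : ∀ r, S.p r + ζ ≠ 0) (h₂ : ∀ r, S.p r - ζ ≠ 0)
    (hA : S.specA Γ Lam Ups ζ = 0) :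
    ∃ c : ℂ, ∀ n, Ups n ζ = c * planeWave S.p n ζ * Lam n ζ := by
  have hpt : Γ.pt 1 = Γ.pt 0 + Pi.single (Γ.dir 0) 1 := by simpa using Γ.step 0
  have hρ := planeWave_ne_zero h₁ h₂ (Γ.pt 0)
  have hρ1 : planeWave S.p (Γ.pt 1) ζ
      = planeWave S.p (Γ.pt 0) ζ * ((S.p (Γ.dir 0) + ζ) / (S.p (Γ.dir 0) - ζ)) := by
    rw [hpt, planeWave_add_single h₁ h₂]
  have hd := h₂ (Γ.dir 0)
  have hs := h₁ (Γ.dir 0)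
  have hAn : (S.p (Γ.dir 0) + ζ) * Ups (Γ.pt 0) ζ * Lam (Γ.pt 1) ζ
      - (S.p (Γ.dir 0) - ζ) * Ups (Γ.pt 1) ζ * Lam (Γ.pt 0) ζ = 0 := by
    rw [specA, div_eq_zero_iff] at hA
    exact hA.resolve_right (mul_ne_zero two_ne_zero hζ0)
  suffices h : ∃ c : ℂ, Ups (Γ.pt 0) ζ = c * (planeWave S.p (Γ.pt 0) ζ * Lam (Γ.pt 0) ζ)
      ∧ Ups (Γ.pt 1) ζ = c * (planeWave S.p (Γ.pt 1) ζ * Lam (Γ.pt 1) ζ) by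
    obtain ⟨c, hc0, hc1⟩ := h
    refine ⟨c, fun n => ?_⟩
    have h := ((hJ.solves_ups hζ).sub
      (((hJ.solves_lam hζ).planeWave_mul h₁ h₂).const_mul c)).eq_zero
      (fun r => by rw [← sub_eq_add_neg]; exact h₂ r)
      (fun r => by rw [sub_neg_eq_add]; exact h₁ r) Γ (sub_eq_zero.2 hc0) (sub_eq_zero.2 hc1) n
    linear_combination h
  by_cases h0 : Lam (Γ.pt 0) ζ = 0
  · have h1 : Lam (Γ.pt 1) ζ ≠ 0 := by
      intro h1
      have hz := (hJ.solves_lam hζ).eq_zero h₁ h₂ Γ h0 h1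
      have hlim := hJ.tendsto_lam hζ
      simp only [hz] at hlim
      exact one_ne_zero (tendsto_nhds_unique hlim tendsto_const_nhds)
    have hU : Ups (Γ.pt 0) ζ = 0 := by
      rw [h0, mul_zero, sub_zero] at hAn
      exact (mul_eq_zero.1 ((mul_eq_zero.1 hAn).resolve_right h1)).resolve_left hs
    have hρ1' := planeWave_ne_zero h₁ h₂ (Γ.pt 1)
    refine ⟨Ups (Γ.pt 1) ζ / (planeWave S.p (Γ.pt 1) ζ * Lam (Γ.pt 1) ζ), ?_, ?_⟩
    · rw [hU, h0, mul_zero, mul_zero]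
    · field_simp
  · refine ⟨Ups (Γ.pt 0) ζ / (planeWave S.p (Γ.pt 0) ζ * Lam (Γ.pt 0) ζ), ?_, ?_⟩
    · field_simp
    · rw [hρ1]
      field_simp
      linear_combination -hAn

end Q3Solution

namespace ClosedContour

variable {L : ClosedContour}

/-! ### The uniqueness mechanism -/

/-- The Cauchy transform, at a point `w` outside, of the function `X` against the density `κ` on
the contour together with the point masses `μ` at the points of `Z`. -/
noncomputable def cauchyTransform (L : ClosedContour) (κ μ : ℂ → ℂ) (Z : Finset ℂ) (X : ℂ → ℂ)
    (w : ℂ) : ℂ :=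
  (2 * Real.pi * Complex.I)⁻¹ * L.integral (fun σ => κ σ * X σ * (σ - w)⁻¹)
    - ∑ z ∈ Z, μ z * X z * (z - w)⁻¹

theorem tendsto_neg_cocompact : Tendsto (fun z : ℂ => -z) (cocompact ℂ) (cocompact ℂ) :=
  (Homeomorph.neg ℂ).isClosedEmbedding.tendsto_cocompact

theorem differentiableOn_cauchyTransform {κ μ X : ℂ → ℂ} {Z : Finset ℂ}
    (hZ : ∀ z ∈ Z, z ∈ L.inside) (hX : L.Integrable (fun σ => κ σ * X σ)) :
    DifferentiableOn ℂ (L.cauchyTransform κ μ Z X) L.outside := by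
  unfold cauchyTransform
  refine (((differentiableOn_cauchyIntegral hX).mono
    (fun w (hw : w ∈ L.outside) => (hw.1 : w ∈ L.traceᶜ))).const_mul _).sub ?_
  refine DifferentiableOn.fun_sum fun z hz => ?_
  refine DifferentiableOn.const_mul ?_ _
  refine DifferentiableOn.inv (by fun_prop) fun w hw h => ?_
  exact notMem_outside_of_mem_inside (hZ z hz) (sub_eq_zero.1 h ▸ hw)

theorem tendsto_mul_cauchyTransform {κ μ X : ℂ → ℂ} {Z : Finset ℂ}
    (hX : L.Integrable (fun σ => κ σ * X σ)) :
    ∃ α, Tendsto (fun w => w * L.cauchyTransform κ μ Z X w) (cocompact ℂ) (𝓝 α) := by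
  obtain ⟨α, hα⟩ := tendsto_mul_cauchyIntegral hX
  have hpole : ∀ z : ℂ, Tendsto (fun w => w * (z - w)⁻¹) (cocompact ℂ) (𝓝 (-1)) := by
    intro z
    have h1 : Tendsto (fun w : ℂ => z - w) (cocompact ℂ) (cocompact ℂ) :=
      (Homeomorph.subLeft z).isClosedEmbedding.tendsto_cocompact
    have h2 : Tendsto (fun w : ℂ => -1 + z * (z - w)⁻¹) (cocompact ℂ) (𝓝 (-1 + z * 0)) :=
      ((Filter.tendsto_inv₀_cobounded.comp (by rwa [Metric.cobounded_eq_cocompact])).const_mul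
        z).const_add (-1)
    rw [mul_zero, add_zero] at h2
    refine h2.congr' ?_
    have h3 : ∀ᶠ w in cocompact ℂ, w ≠ z :=
      (isCompact_singleton (x := z)).compl_mem_cocompact
    filter_upwards [h3] with w hw
    have : z - w ≠ 0 := sub_ne_zero.2 hw.symm
    field_simp
    ring
  have hsum : Tendsto (fun w => ∑ z ∈ Z, μ z * X z * (w * (z - w)⁻¹)) (cocompact ℂ)
      (𝓝 (∑ z ∈ Z, μ z * X z * (-1))) :=
    tendsto_finsetSum _ fun z _ => (hpole z).const_mul _
  refine ⟨_, ((hα.const_mul (2 * Real.pi * Complex.I)⁻¹).sub hsum).congr fun w => ?_⟩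
  unfold cauchyTransform
  rw [mul_sub, Finset.mul_sum]
  congr 1
  · ring
  · exact Finset.sum_congr rfl fun z _ => by ring

/-- Two functions `d` and `M` that are, under `z ↦ -z`, Cauchy transforms of themselves (`M` up to
an entire term `e`) satisfy `d (-w) * M w = M (-w) * d w`. In the difference of both sides the
Cauchy kernel acts on `d σ * M w - M σ * d w`, which vanishes at `σ = w`. Hence the difference
continues analytically across the contour to its interior, and, being odd, to the whole plane;
it vanishes at infinity. -/
theorem mul_neg_eq_of_cauchyTransform {κ μ : ℂ → ℂ} {Z : Finset ℂ}
    (hκ : ContinuousOn κ L.trace) (hZ : ∀ z ∈ Z, z ∈ L.inside)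
    (hrefl : ∀ z ∈ L.inside ∪ L.trace, -z ∈ L.outside) {d M e : ℂ → ℂ}
    (hd : DifferentiableOn ℂ d {z | -z ∈ L.outside})
    (hM : DifferentiableOn ℂ M {z | -z ∈ L.outside}) (he : Differentiable ℂ e)
    (hdK : ∀ w ∈ L.outside, d (-w) = L.cauchyTransform κ μ Z d w)
    (hMK : ∀ w ∈ L.outside, M (-w) = e w + L.cauchyTransform κ μ Z M w) {α β : ℂ}
    (hdα : Tendsto (fun z => z * d z) (cocompact ℂ) (𝓝 α))
    (hMβ : Tendsto (fun z => M z / z) (cocompact ℂ) (𝓝 β)) {w : ℂ} (hw : w ∈ L.outside)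
    (hw' : -w ∈ L.outside) : d (-w) * M w = M (-w) * d w := by
  classical
  set W : Set ℂ := {z | -z ∈ L.outside} with hWdef
  have hW : IsOpen W := isOpen_outside.preimage continuous_neg
  have hsub : L.inside ∪ L.trace ⊆ W := hrefl
  have hLW : L.trace ⊆ W := subset_union_right.trans hsub
  have hκi : IntervalIntegrable (fun t => κ (L.path t) * deriv L.path t)
      MeasureTheory.volume 0 1 := integrable_of_continuousOn hκ
  set T : (ℂ → ℂ) → ℂ → ℂ := fun f z => (2 * Real.pi * Complex.I)⁻¹
    * (∫ t in (0 : ℝ)..1, (κ (L.path t) * deriv L.path t) * dslope f z (L.path t))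
    - ∑ k ∈ Z, μ k * dslope f k z with hT
  have hTd : ∀ f, DifferentiableOn ℂ f W → DifferentiableOn ℂ (T f) W := by
    intro f hf
    refine ((differentiableOn_integral_dslope hκi hW hLW hf).const_mul _).sub ?_
    refine DifferentiableOn.fun_sum fun k hk => DifferentiableOn.const_mul ?_ _
    exact (Complex.differentiableOn_dslope
      (hW.mem_nhds (hsub (Or.inl (hZ k hk))))).2 hf
  have hTK : ∀ f, DifferentiableOn ℂ f W → ∀ z ∈ L.outside,
      T f z = L.cauchyTransform κ μ Z f z - f z * L.cauchyTransform κ μ Z (fun _ => 1) z := by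
    intro f hf z hz
    have hc : ContinuousOn (fun σ => κ σ * f σ) L.trace := hκ.mul (hf.continuousOn.mono hLW)
    have h1 : (∫ t in (0 : ℝ)..1, (κ (L.path t) * deriv L.path t) * dslope f z (L.path t))
        = L.integral (fun σ => κ σ * f σ * (σ - z)⁻¹)
          - f z * L.integral (fun σ => κ σ * 1 * (σ - z)⁻¹) := by
      have hi : L.Integrable (fun σ => κ σ * 1 * (σ - z)⁻¹) :=
        (integrable_of_continuousOn (hκ.mul continuousOn_const)).mul_inv_sub hz.1
      rw [← integral_const_mul, ← integral_sub
        ((integrable_of_continuousOn hc).mul_inv_sub hz.1) (hi.const_mul _)]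
      refine intervalIntegral.integral_congr fun t ht => ?_
      rw [uIcc_of_le zero_le_one] at ht
      have hne := ne_of_notMem_trace hz.1 (L.path_mem_trace ht)
      simp only
      rw [dslope_of_ne _ (sub_ne_zero.1 hne), slope_def_field]
      field_simp
    have h2 : ∑ k ∈ Z, μ k * dslope f k z
        = ∑ k ∈ Z, μ k * f k * (k - z)⁻¹ - f z * ∑ k ∈ Z, μ k * 1 * (k - z)⁻¹ := by
      rw [Finset.mul_sum, ← Finset.sum_sub_distrib]
      refine Finset.sum_congr rfl fun k hk => ?_
      have hne : k ≠ z := fun h => notMem_outside_of_mem_inside (hZ k hk) (h ▸ hz)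
      have hne' : k - z ≠ 0 := sub_ne_zero.2 hne
      rw [dslope_comm, dslope_of_ne _ hne, slope_def_field]
      field_simp
    simp only [hT, cauchyTransform]
    rw [h1, h2]
    ring
  -- the analytic continuation of `d (-z) * M z - M (-z) * d z` to `W`
  set q : ℂ → ℂ := fun z => M z * T d z - d z * T M z - e z * d z with hq
  have hqd : DifferentiableOn ℂ q W :=
    ((hM.mul (hTd d hd)).sub (hd.mul (hTd M hM))).sub (he.differentiableOn.mul hd)
  have hqeq : ∀ z ∈ L.outside, q z = d (-z) * M z - M (-z) * d z := by
    intro z hz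
    simp only [hq]
    rw [hTK d hd z hz, hTK M hM z hz, hdK z hz, hMK z hz]
    ring
  have hodd : ∀ z ∈ L.outside, -z ∈ L.outside → q z = -q (-z) := by
    intro z hz hz'
    rw [hqeq z hz, hqeq (-z) hz', neg_neg]
    ring
  set Q : ℂ → ℂ := fun z => if -z ∈ L.outside then q z else -q (-z) with hQ
  have hQd : Differentiable ℂ Q := by
    intro z
    by_cases hz : -z ∈ L.outside
    · refine (hqd.differentiableAt (hW.mem_nhds hz)).congr_of_eventuallyEq ?_
      filter_upwards [hW.mem_nhds hz] with u hu
      exact if_pos hu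
    · have hz2 : z ∈ L.outside := by
        have h := hrefl _ (notMem_outside_iff.1 hz)
        rwa [neg_neg] at h
      have hz3 : -z ∈ W := by rwa [hWdef, mem_ofPred_eq, neg_neg]
      have h1 : DifferentiableAt ℂ (fun u => -q (-u)) z :=
        ((hqd.differentiableAt (hW.mem_nhds hz3)).comp z differentiableAt_id.neg).neg
      refine h1.congr_of_eventuallyEq ?_
      filter_upwards [isOpen_outside.mem_nhds hz2] with u hu
      by_cases hu' : -u ∈ L.outside
      · simp only [hQ, hu', if_true]
        exact hodd u hu hu'
      · simp only [hQ, hu', if_false]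
  have hlim : Tendsto Q (cocompact ℂ) (𝓝 0) := by
    have h1 := ((hdα.comp tendsto_neg_cocompact).neg.mul hMβ).add
      ((hMβ.comp tendsto_neg_cocompact).mul hdα)
    have h0 : -α * β + β * α = 0 := by ring
    rw [h0] at h1
    refine h1.congr' ?_
    have hne : ∀ᶠ z in cocompact ℂ, z ≠ (0 : ℂ) :=
      (isCompact_singleton (x := (0 : ℂ))).compl_mem_cocompact
    filter_upwards [eventually_mem_outside (L := L),
      tendsto_neg_cocompact.eventually (eventually_mem_outside (L := L)), hne] with z hz hz' hz0
    simp only [hQ, hz', if_true, Function.comp_apply]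
    rw [hqeq z hz]
    field_simp
    ring
  have h0 := hQd.apply_eq_of_tendsto_cocompact w hlim
  rw [hQ] at h0
  simp only [hw', if_true] at h0
  rw [hqeq w hw] at h0
  exact sub_eq_zero.1 h0

end ClosedContour

/-! ### The singular integral equation -/

namespace Q3Solution

variable {N : ℕ} {S : Q3Solution N} {Γ : Staircase N} {K : ℝ} {L : ClosedContour}
  {Lam Ups : (Fin N → ℤ) → ℂ → ℂ}

/-- The density `R ρ` of the contour integral in the singular integral equation. -/
noncomputable def density (S : Q3Solution N) (Γ : Staircase N) (Lam Ups : (Fin N → ℤ) → ℂ → ℂ)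
    (n : Fin N → ℤ) (σ : ℂ) : ℂ :=
  S.specB Γ Lam Ups σ / S.specA Γ Lam Ups σ * planeWave S.p n σ

/-- The point masses `C_j ρ` in the singular integral equation. -/
noncomputable def mass (S : Q3Solution N) (Γ : Staircase N) (Lam Ups : (Fin N → ℤ) → ℂ → ℂ)
    (K : ℝ) (c : ℂ → ℂ) (n : Fin N → ℤ) (z : ℂ) : ℂ :=
  S.normC Γ Lam Ups K c z * planeWave S.p n z

theorem solvesIntegralEq_iff (hfin : (S.zerosA Γ Lam Ups K).Finite) {c : ℂ → ℂ}
    {n : Fin N → ℤ} {f : ℂ → ℂ} :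
    S.SolvesIntegralEq Γ Lam Ups K L c n f ↔
      L.Integrable (fun σ => S.density Γ Lam Ups n σ * f σ) ∧ ∀ w ∈ L.outside,
        f (-w) = 1 + L.cauchyTransform (S.density Γ Lam Ups n) (S.mass Γ Lam Ups K c n)
          hfin.toFinset f w := by
  have hdens : (fun σ => S.specB Γ Lam Ups σ / S.specA Γ Lam Ups σ * f σ * planeWave S.p n σ)
      = fun σ => S.density Γ Lam Ups n σ * f σ := by
    ext σ
    simp only [density]
    ring
  have hrhs : ∀ w : ℂ, 1 - ∑ᶠ z ∈ S.zerosA Γ Lam Ups K,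
          S.normC Γ Lam Ups K c z * f z / (-w + z) * planeWave S.p n z
      + 1 / (2 * Real.pi * Complex.I) * L.integral (fun σ =>
          S.specB Γ Lam Ups σ / S.specA Γ Lam Ups σ * f σ / (σ + -w) * planeWave S.p n σ)
      = 1 + L.cauchyTransform (S.density Γ Lam Ups n) (S.mass Γ Lam Ups K c n)
          hfin.toFinset f w := by
    intro w
    rw [finsum_mem_eq_finite_toFinset_sum _ hfin]
    unfold ClosedContour.cauchyTransform
    have h1 : ∑ z ∈ hfin.toFinset, S.normC Γ Lam Ups K c z * f z / (-w + z) * planeWave S.p n z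
        = ∑ z ∈ hfin.toFinset, S.mass Γ Lam Ups K c n z * f z * (z - w)⁻¹ := by
      refine Finset.sum_congr rfl fun z _ => ?_
      simp only [mass, neg_add_eq_sub, div_eq_mul_inv]
      ring
    have h2 : (fun σ => S.specB Γ Lam Ups σ / S.specA Γ Lam Ups σ * f σ / (σ + -w)
        * planeWave S.p n σ) = fun σ => S.density Γ Lam Ups n σ * f σ * (σ - w)⁻¹ := by
      ext σ
      simp only [density, ← sub_eq_add_neg, div_eq_mul_inv]
      ring
    rw [h1, h2]
    ring
  unfold SolvesIntegralEq
  rw [hdens]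
  refine and_congr_right fun _ => ⟨fun h w hw => ?_, fun h ζ hζ => ?_⟩
  · rw [← hrhs]
    exact h (-w) (by rwa [neg_neg])
  · have := h (-ζ) hζ
    rw [← hrhs, neg_neg] at this
    exact this

/-- The hypotheses on the contour and on the Jost functions, in the form in which they are used. -/
structure ScatteringData (S : Q3Solution N) (Γ : Staircase N) (K : ℝ) (L : ClosedContour)
    (Lam Ups : (Fin N → ℤ) → ℂ → ℂ) : Prop where
  p_ne : ∀ i, S.p (Γ.dir i) ≠ 0
  one_lt : 1 < K
  oriented : L.PositivelyOriented
  pStar_subset : S.regionPStar Γ K ⊆ L.inside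
  zero_mem : (0 : ℂ) ∈ L.outside
  refl : ∀ z ∈ L.inside ∪ L.trace, -z ∈ L.outside
  p_notMem : ∀ r, S.p r ∉ L.trace ∧ -S.p r ∉ L.trace
  jost : S.IsJost Γ K (S.exceptional L) Lam Ups
  adm : S.Admissible Γ Lam Ups K
  zeros_subset : S.zerosA Γ Lam Ups K ⊆ L.inside
  zeros_ne : ∀ z ∈ S.zerosA Γ Lam Ups K, ∀ r, z ≠ S.p r ∧ z ≠ -S.p r

namespace ScatteringData

theorem notMem_singular (D : S.ScatteringData Γ K L Lam Ups) {z : ℂ} (hz : -z ∈ L.outside) :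
    z ∉ S.regionP Γ K ∪ S.exceptional L := by
  have h := neg_notMem_singular (S := S) D.pStar_subset (Or.inl hz)
  rwa [neg_neg] at h

theorem isOpen_reflected (L : ClosedContour) : IsOpen {z : ℂ | -z ∈ L.outside} :=
  ClosedContour.isOpen_outside.preimage continuous_neg

/-- The reflected exterior is open and disjoint from `𝒫`, hence from its closure. -/
theorem notMem_closure (D : S.ScatteringData Γ K L Lam Ups) {z : ℂ} (hz : -z ∈ L.outside) :
    z ∉ closure (S.regionP Γ K) :=
  disjoint_left.1 ((disjoint_left.2 fun _ hu h =>
    D.notMem_singular hu (Or.inl h) : Disjoint {z : ℂ | -z ∈ L.outside}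
      (S.regionP Γ K)).closure_right (isOpen_reflected L)) hz

theorem lam_ext (D : S.ScatteringData Γ K L Lam Ups) (n : Fin N → ℤ) :
    L.IsExteriorCauchy (fun σ => Lam n (-σ)) 1 :=
  isExteriorCauchy_lam D.oriented D.one_lt D.p_ne D.pStar_subset D.p_notMem D.jost D.adm n

theorem differentiableOn_of_ext {g : ℂ → ℂ} {c : ℂ}
    (hg : L.IsExteriorCauchy (fun σ => g (-σ)) c) :
    DifferentiableOn ℂ g {z | -z ∈ L.outside} := by
  have h := hg.differentiableOn.comp (differentiableOn_id.neg)
    (fun z (hz : z ∈ {z : ℂ | -z ∈ L.outside}) => hz)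
  simpa [Function.comp_def] using h

theorem differentiableOn_lam (D : S.ScatteringData Γ K L Lam Ups) (n : Fin N → ℤ) :
    DifferentiableOn ℂ (Lam n) {z | -z ∈ L.outside} :=
  differentiableOn_of_ext (D.lam_ext n)

theorem differentiableOn_ups (D : S.ScatteringData Γ K L Lam Ups) (n : Fin N → ℤ) :
    DifferentiableOn ℂ (Ups n) {z | -z ∈ L.outside} :=
  differentiableOn_of_ext
    (isExteriorCauchy_ups D.oriented D.one_lt D.p_ne D.pStar_subset D.p_notMem D.jost D.adm n)

theorem tendsto_lam (D : S.ScatteringData Γ K L Lam Ups) (n : Fin N → ℤ) :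
    Tendsto (Lam n) (cocompact ℂ) (𝓝 1) := by
  simpa [Function.comp_def] using (D.lam_ext n).tendsto.comp ClosedContour.tendsto_neg_cocompact

theorem differentiableOn_specA (D : S.ScatteringData Γ K L Lam Ups) :
    DifferentiableOn ℂ (S.specA Γ Lam Ups) ({z | -z ∈ L.outside} \ {0}) := by
  have hl := fun n => (D.differentiableOn_lam n).mono
    (sdiff_subset : {z : ℂ | -z ∈ L.outside} \ {0} ⊆ _)
  have hu := fun n => (D.differentiableOn_ups n).mono
    (sdiff_subset : {z : ℂ | -z ∈ L.outside} \ {0} ⊆ _)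
  unfold specA
  refine DifferentiableOn.div ((DifferentiableOn.mul (DifferentiableOn.mul (by fun_prop) (hu _))
    (hl _)).sub (DifferentiableOn.mul (DifferentiableOn.mul (by fun_prop) (hu _)) (hl _)))
    (by fun_prop) fun z hz => mul_ne_zero two_ne_zero hz.2

theorem interior_subset (D : S.ScatteringData Γ K L Lam Ups) :
    L.inside ∪ L.trace ⊆ {z : ℂ | -z ∈ L.outside} \ {0} := by
  intro z hz
  refine ⟨D.refl z hz, ?_⟩
  rintro rfl
  exact ClosedContour.notMem_outside_iff.2 hz D.zero_mem

theorem specA_eq_zero_iff (D : S.ScatteringData Γ K L Lam Ups) {z : ℂ}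
    (hz : z ∈ {z : ℂ | -z ∈ L.outside} \ {0}) :
    S.specA Γ Lam Ups z = 0 ↔ z ∈ S.zerosA Γ Lam Ups K :=
  ⟨fun h => ⟨hz.2, D.notMem_closure hz.1, h⟩, fun h => h.2.2⟩

theorem specA_ne_zero (D : S.ScatteringData Γ K L Lam Ups) {σ : ℂ} (hσ : σ ∈ L.trace) :
    S.specA Γ Lam Ups σ ≠ 0 := fun h =>
  (D.zeros_subset ((D.specA_eq_zero_iff (D.interior_subset (Or.inr hσ))).1 h)).1 hσ

theorem ne_zero_of_mem_trace (D : S.ScatteringData Γ K L Lam Ups) {σ : ℂ} (hσ : σ ∈ L.trace) :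
    σ ≠ 0 := (D.interior_subset (Or.inr hσ)).2

theorem add_ne_zero_of_mem_trace (D : S.ScatteringData Γ K L Lam Ups) {σ : ℂ}
    (hσ : σ ∈ L.trace) (r : Fin N) : S.p r + σ ≠ 0 := fun h =>
  (D.p_notMem r).2 ((eq_neg_of_add_eq_zero_right h) ▸ hσ)

theorem sub_ne_zero_of_mem_trace (D : S.ScatteringData Γ K L Lam Ups) {σ : ℂ}
    (hσ : σ ∈ L.trace) (r : Fin N) : S.p r - σ ≠ 0 := fun h =>
  (D.p_notMem r).1 ((sub_eq_zero.1 h) ▸ hσ)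

theorem continuousOn_density (D : S.ScatteringData Γ K L Lam Ups) (n : Fin N → ℤ) :
    ContinuousOn (S.density Γ Lam Ups n) L.trace := by
  have hsub : L.trace ⊆ {z : ℂ | -z ∈ L.outside} := fun z hz => D.refl z (Or.inr hz)
  have hρ := fun m => continuousOn_planeWave (p := S.p) (s := L.trace)
    (fun _ hσ => D.add_ne_zero_of_mem_trace hσ) (fun _ hσ => D.sub_ne_zero_of_mem_trace hσ) m
  have hu := fun m => (D.differentiableOn_ups m).continuousOn.mono hsub
  have hl := fun m => (D.lam_ext m).cont
  have hB : ContinuousOn (S.specB Γ Lam Ups) L.trace := by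
    unfold specB
    refine ContinuousOn.mul (ContinuousOn.mul (ContinuousOn.div (by fun_prop) (by fun_prop) ?_)
      ((hρ _).inv₀ ?_)) (((hl _).mul (hu _)).sub ((hl _).mul (hu _)))
    · exact fun σ hσ => mul_ne_zero two_ne_zero (D.ne_zero_of_mem_trace hσ)
    · exact fun σ hσ => planeWave_ne_zero (D.add_ne_zero_of_mem_trace hσ)
        (D.sub_ne_zero_of_mem_trace hσ) _
  exact (hB.div (D.differentiableOn_specA.continuousOn.mono
    (subset_union_right.trans D.interior_subset)) fun σ hσ => D.specA_ne_zero hσ).mul (hρ n)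

/-- The residue of `Υ / A` at a zero of `A`. -/
theorem ups_div_deriv_eq (D : S.ScatteringData Γ K L Lam Ups) {c : ℂ → ℂ}
    (hc : ∀ z ∈ S.zerosA Γ Lam Ups K, ∀ n, Ups n z = c z * planeWave S.p n z * Lam n z)
    (n : Fin N → ℤ) {z : ℂ} (hz : z ∈ S.zerosA Γ Lam Ups K) :
    Ups n z / deriv (S.specA Γ Lam Ups) z = S.mass Γ Lam Ups K c n z * Lam n z := by
  have hins := D.zeros_subset hz
  unfold mass normC
  split_ifs with hP
  · rw [hc z hz n]
    ring
  · have hζ := D.notMem_singular (D.refl z (Or.inl hins))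
    have hζ' : -z ∉ S.regionP Γ K ∪ S.exceptional L := by
      rintro (h | ⟨r, -, h⟩)
      · exact hP (neg_mem_regionP_iff.1 h)
      · exact (D.zeros_ne z hz r).1 (neg_inj.1 h)
    rw [D.jost.ups_eq hz.1 hζ hζ'
      (fun r h => (D.zeros_ne z hz r).2 (eq_neg_of_add_eq_zero_right h))
      (fun r h => (D.zeros_ne z hz r).1 (sub_eq_zero.1 h).symm) n, hz.2.2]
    ring

/-- The Jost function `Λ` solves the singular integral equation: `Λ(·;-σ)` is given outside the
contour by its exterior Cauchy formula, and on the contour it equals `Υ / A - R ρ Λ`, whose first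
term is meromorphic inside. -/
theorem lam_eq (D : S.ScatteringData Γ K L Lam Ups) {c : ℂ → ℂ}
    (hc : ∀ z ∈ S.zerosA Γ Lam Ups K, ∀ n, Ups n z = c z * planeWave S.p n z * Lam n z)
    (n : Fin N → ℤ) {w : ℂ} (hw : w ∈ L.outside) :
    Lam n (-w) = 1 + L.cauchyTransform (S.density Γ Lam Ups n) (S.mass Γ Lam Ups K c n)
      D.adm.finite_zeros.toFinset (Lam n) w := by
  have hlt : ContinuousOn (Lam n) L.trace :=
    (D.differentiableOn_lam n).continuousOn.mono fun z hz => D.refl z (Or.inr hz)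
  have hWo : IsOpen ({z : ℂ | -z ∈ L.outside} \ {0}) :=
    (isOpen_reflected L).sdiff isClosed_singleton
  have hut : DifferentiableOn ℂ (Ups n) ({z | -z ∈ L.outside} \ {0}) :=
    (D.differentiableOn_ups n).mono sdiff_subset
  have hrel : ∀ σ ∈ L.trace, Lam n (-σ) * (σ - w)⁻¹
      = Ups n σ / S.specA Γ Lam Ups σ * (σ - w)⁻¹
        - S.density Γ Lam Ups n σ * Lam n σ * (σ - w)⁻¹ := by
    intro σ hσ
    have h := D.jost.ups_eq (D.ne_zero_of_mem_trace hσ)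
      (D.notMem_singular (D.refl σ (Or.inr hσ))) (neg_notMem_singular D.pStar_subset (Or.inr hσ))
      (D.add_ne_zero_of_mem_trace hσ) (D.sub_ne_zero_of_mem_trace hσ) n
    have hA := D.specA_ne_zero hσ
    rw [h, density]
    field_simp
    ring
  have hsubt : L.trace ⊆ {z : ℂ | -z ∈ L.outside} \ {0} :=
    subset_union_right.trans D.interior_subset
  have hout := (D.lam_ext n).outside w hw
  rw [ClosedContour.integral_congr hrel, ClosedContour.integral_sub
    ((ClosedContour.integrable_of_continuousOn (g := fun σ => Ups n σ / S.specA Γ Lam Ups σ)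
      ((hut.continuousOn.mono hsubt).div
      (D.differentiableOn_specA.continuousOn.mono hsubt) fun σ hσ =>
        D.specA_ne_zero hσ)).mul_inv_sub hw.1)
    ((ClosedContour.integrable_of_continuousOn (g := fun σ => S.density Γ Lam Ups n σ * Lam n σ)
      ((D.continuousOn_density n).mul hlt)).mul_inv_sub hw.1),
    ClosedContour.cauchyIntegral_div D.oriented hWo D.interior_subset hut D.differentiableOn_specA
      D.adm.finite_zeros.toFinset (fun z hz => D.zeros_subset (by simpa using hz))
      (fun z hz => by rw [D.specA_eq_zero_iff hz]; simp)
      (fun z hz => D.adm.simple_zeros z (by simpa using hz)) hw] at hout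
  have hres : ∑ z ∈ D.adm.finite_zeros.toFinset,
        Ups n z / deriv (S.specA Γ Lam Ups) z * (z - w)⁻¹
      = ∑ z ∈ D.adm.finite_zeros.toFinset,
        S.mass Γ Lam Ups K c n z * Lam n z * (z - w)⁻¹ :=
    Finset.sum_congr rfl fun z hz => by rw [D.ups_div_deriv_eq hc n (by simpa using hz)]
  rw [hres] at hout
  unfold ClosedContour.cauchyTransform
  have hpi := Complex.two_pi_I_ne_zero
  have h2 : ∀ a b s : ℂ, 2 * Real.pi * Complex.I * s - a = 2 * Real.pi * Complex.I * (1 - b) →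
      b = 1 + ((2 * Real.pi * Complex.I)⁻¹ * a - s) := by
    intro a b s h
    have ha : a = 2 * Real.pi * Complex.I * (s - 1 + b) := by linear_combination -h
    rw [ha, inv_mul_cancel_left₀ hpi]
    ring
  exact h2 _ _ _ hout

/-- The neighbour `Λ(n + e_r)`, multiplied by `p_r + ζ`, satisfies the integral equation at `n` up
to a polynomial term. -/
theorem add_mul_lam_eq (D : S.ScatteringData Γ K L Lam Ups) {c : ℂ → ℂ}
    (hc : ∀ z ∈ S.zerosA Γ Lam Ups K, ∀ n, Ups n z = c z * planeWave S.p n z * Lam n z)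
    (n : Fin N → ℤ) (r : Fin N) :
    ∃ a : ℂ, ∀ w ∈ L.outside, (S.p r + -w) * Lam (n + Pi.single r 1) (-w)
      = (a - w) + L.cauchyTransform (S.density Γ Lam Ups n) (S.mass Γ Lam Ups K c n)
        D.adm.finite_zeros.toFinset (fun z => (S.p r + z) * Lam (n + Pi.single r 1) z) w := by
  set Lr := Lam (n + Pi.single r 1)
  set Z := D.adm.finite_zeros.toFinset with hZdef
  have hlt : ContinuousOn Lr L.trace :=
    (D.differentiableOn_lam _).continuousOn.mono fun z hz => D.refl z (Or.inr hz)
  set κ := S.density Γ Lam Ups n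
  set μ := S.mass Γ Lam Ups K c n
  have hκ : ContinuousOn κ L.trace := D.continuousOn_density n
  refine ⟨S.p r + ((2 * Real.pi * Complex.I)⁻¹
      * L.integral (fun σ => κ σ * ((S.p r + σ) * Lr σ) * (S.p r - σ)⁻¹)
    - ∑ z ∈ Z, μ z * ((S.p r + z) * Lr z) * (S.p r - z)⁻¹), fun w hw => ?_⟩
  have hker : ∀ σ, S.p r - σ ≠ 0 → σ - w ≠ 0 →
      (S.p r - w) * ((S.p r + σ) / (S.p r - σ)) * (σ - w)⁻¹
        = (S.p r + σ) * (σ - w)⁻¹ + (S.p r + σ) * (S.p r - σ)⁻¹ := by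
    intro σ h1 h2
    field_simp
    ring
  have hint : (S.p r - w)
        * L.integral (fun σ => S.density Γ Lam Ups (n + Pi.single r 1) σ * Lr σ * (σ - w)⁻¹)
      = L.integral (fun σ => κ σ * ((S.p r + σ) * Lr σ) * (σ - w)⁻¹)
        + L.integral (fun σ => κ σ * ((S.p r + σ) * Lr σ) * (S.p r - σ)⁻¹) := by
    have hc1 : ContinuousOn (fun σ => κ σ * ((S.p r + σ) * Lr σ)) L.trace :=
      hκ.mul (ContinuousOn.mul (by fun_prop) hlt)
    rw [← ClosedContour.integral_const_mul, ← ClosedContour.integral_add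
      ((ClosedContour.integrable_of_continuousOn hc1).mul_inv_sub hw.1)
      ((ClosedContour.integrable_of_continuousOn hc1).mul_continuousOn
        (k := fun σ => (S.p r - σ)⁻¹) (ContinuousOn.inv₀ (by fun_prop)
        fun σ hσ => D.sub_ne_zero_of_mem_trace hσ r))]
    refine ClosedContour.integral_congr fun σ hσ => ?_
    have h := hker σ (D.sub_ne_zero_of_mem_trace hσ r) (ClosedContour.ne_of_notMem_trace hw.1 hσ)
    simp only [κ, density, planeWave_add_single (D.add_ne_zero_of_mem_trace hσ)
      (D.sub_ne_zero_of_mem_trace hσ)]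
    linear_combination (S.specB Γ Lam Ups σ / S.specA Γ Lam Ups σ * planeWave S.p n σ * Lr σ) * h
  have hsum : (S.p r - w)
        * ∑ z ∈ Z, S.mass Γ Lam Ups K c (n + Pi.single r 1) z * Lr z * (z - w)⁻¹
      = ∑ z ∈ Z, μ z * ((S.p r + z) * Lr z) * (z - w)⁻¹
        + ∑ z ∈ Z, μ z * ((S.p r + z) * Lr z) * (S.p r - z)⁻¹ := by
    rw [Finset.mul_sum, ← Finset.sum_add_distrib]
    refine Finset.sum_congr rfl fun z hz => ?_
    have hz' : z ∈ S.zerosA Γ Lam Ups K := by simpa [hZdef] using hz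
    have h1 : ∀ r, S.p r + z ≠ 0 := fun r h =>
      (D.zeros_ne z hz' r).2 (eq_neg_of_add_eq_zero_right h)
    have h2 : ∀ r, S.p r - z ≠ 0 := fun r h => (D.zeros_ne z hz' r).1 (sub_eq_zero.1 h).symm
    have h := hker z (h2 r) (sub_ne_zero.2 fun h =>
      ClosedContour.notMem_outside_of_mem_inside (D.zeros_subset hz') (h ▸ hw))
    simp only [μ, mass, planeWave_add_single h1 h2]
    linear_combination (S.normC Γ Lam Ups K c z * planeWave S.p n z * Lr z) * h
  have heq := D.lam_eq hc (n + Pi.single r 1) hw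
  change Lr (-w) = 1 + ((2 * Real.pi * Complex.I)⁻¹
      * L.integral (fun σ => S.density Γ Lam Ups (n + Pi.single r 1) σ * Lr σ * (σ - w)⁻¹)
    - ∑ z ∈ Z, S.mass Γ Lam Ups K c (n + Pi.single r 1) z * Lr z * (z - w)⁻¹) at heq
  unfold ClosedContour.cauchyTransform
  beta_reduce
  rw [heq]
  linear_combination (2 * Real.pi * Complex.I)⁻¹ * hint - hsum

/-- Uniqueness. The difference `d` of two solutions is compared with `Λ(n)` and with the neighbour
`Λ(n + e_r)`; the nonvanishing Wronskian of these forces `d = 0`. -/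
theorem eq_lam_of_eq (D : S.ScatteringData Γ K L Lam Ups) {c : ℂ → ℂ}
    (hc : ∀ z ∈ S.zerosA Γ Lam Ups K, ∀ n, Ups n z = c z * planeWave S.p n z * Lam n z)
    (n : Fin N → ℤ) {f : ℂ → ℂ} (hfi : L.Integrable (fun σ => S.density Γ Lam Ups n σ * f σ))
    (hf : ∀ w ∈ L.outside, f (-w) = 1 + L.cauchyTransform (S.density Γ Lam Ups n)
      (S.mass Γ Lam Ups K c n) D.adm.finite_zeros.toFinset f w) :
    EqOn f (Lam n) {ζ | -ζ ∈ L.outside} := by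
  set W : Set ℂ := {z | -z ∈ L.outside} with hWdef
  have hW : IsOpen W := isOpen_reflected L
  set κ := S.density Γ Lam Ups n
  set μ := S.mass Γ Lam Ups K c n
  set Z := D.adm.finite_zeros.toFinset with hZdef
  have hZ : ∀ z ∈ Z, z ∈ L.inside := fun z hz => D.zeros_subset (by simpa [hZdef] using hz)
  have hκ : ContinuousOn κ L.trace := D.continuousOn_density n
  set d : ℂ → ℂ := fun z => f z - Lam n z with hd
  have hlt : ContinuousOn (Lam n) L.trace :=
    (D.differentiableOn_lam n).continuousOn.mono fun z hz => D.refl z (Or.inr hz)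
  have hli : L.Integrable (fun σ => κ σ * Lam n σ) :=
    ClosedContour.integrable_of_continuousOn (hκ.mul hlt)
  have hdi : L.Integrable (fun σ => κ σ * d σ) := by
    refine IntervalIntegrable.congr (fun t _ => ?_) (IntervalIntegrable.sub hfi hli)
    simp only [hd]
    ring
  have hdK : ∀ w ∈ L.outside, d (-w) = L.cauchyTransform κ μ Z d w := by
    intro w hw
    simp only [hd]
    rw [hf w hw, D.lam_eq hc n hw]
    have h1 : L.integral (fun σ => κ σ * (f σ - Lam n σ) * (σ - w)⁻¹)
        = L.integral (fun σ => κ σ * f σ * (σ - w)⁻¹)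
          - L.integral (fun σ => κ σ * Lam n σ * (σ - w)⁻¹) := by
      rw [← ClosedContour.integral_sub (hfi.mul_inv_sub hw.1) (hli.mul_inv_sub hw.1)]
      refine ClosedContour.integral_congr fun σ _ => ?_
      ring
    have h2 : ∑ z ∈ Z, μ z * (f z - Lam n z) * (z - w)⁻¹
        = ∑ z ∈ Z, μ z * f z * (z - w)⁻¹ - ∑ z ∈ Z, μ z * Lam n z * (z - w)⁻¹ := by
      rw [← Finset.sum_sub_distrib]
      exact Finset.sum_congr rfl fun z _ => by ring
    unfold ClosedContour.cauchyTransform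
    rw [h1, h2]
    ring
  have hdd : DifferentiableOn ℂ d W := by
    have h := (ClosedContour.differentiableOn_cauchyTransform (μ := μ) hZ hdi).comp
      (differentiableOn_id.neg) (fun z (hz : z ∈ W) => hz)
    refine h.congr fun z hz => ?_
    have h2 := hdK (-z) hz
    rw [neg_neg] at h2
    exact h2
  obtain ⟨α, hα⟩ := ClosedContour.tendsto_mul_cauchyTransform (μ := μ) (Z := Z) hdi
  have hne : ∀ᶠ z in cocompact ℂ, z ≠ (0 : ℂ) :=
    (isCompact_singleton (x := (0 : ℂ))).compl_mem_cocompact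
  have hfar : ∀ᶠ z in cocompact ℂ, -z ∈ L.outside :=
    ClosedContour.tendsto_neg_cocompact.eventually ClosedContour.eventually_mem_outside
  have hdα : Tendsto (fun z => z * d z) (cocompact ℂ) (𝓝 (-α)) := by
    refine (hα.comp ClosedContour.tendsto_neg_cocompact).neg.congr' ?_
    filter_upwards [hfar] with z hz
    have h := hdK (-z) hz
    rw [neg_neg] at h
    simp only [Function.comp_apply]
    rw [h]
    ring
  have hinv : Tendsto (fun z : ℂ => z⁻¹) (cocompact ℂ) (𝓝 0) := by
    rw [← Metric.cobounded_eq_cocompact]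
    exact Filter.tendsto_inv₀_cobounded
  have hzero : ∀ w ∈ L.outside, -w ∈ L.outside → w ≠ 0 → d w = 0 := by
    intro w hw hw' hw0
    set r := Γ.dir 0
    have h1 := ClosedContour.mul_neg_eq_of_cauchyTransform hκ hZ D.refl hdd
      (D.differentiableOn_lam n) (e := fun _ => 1) (differentiable_const _) hdK
      (fun w hw => D.lam_eq hc n hw) hdα (β := 0)
      (by simpa [div_eq_mul_inv] using (D.tendsto_lam n).mul hinv) hw hw'
    obtain ⟨a, ha⟩ := D.add_mul_lam_eq hc n r
    have hM : DifferentiableOn ℂ (fun z => (S.p r + z) * Lam (n + Pi.single r 1) z) W :=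
      DifferentiableOn.mul (by fun_prop) (D.differentiableOn_lam _)
    have hMβ : Tendsto (fun z => (S.p r + z) * Lam (n + Pi.single r 1) z / z)
        (cocompact ℂ) (𝓝 1) := by
      have h := ((hinv.const_mul (S.p r)).add_const 1).mul (D.tendsto_lam (n + Pi.single r 1))
      rw [mul_zero, zero_add, one_mul] at h
      refine h.congr' ?_
      filter_upwards [hne] with z hz
      field_simp
    have h2 := ClosedContour.mul_neg_eq_of_cauchyTransform hκ hZ D.refl hdd hM
      (e := fun w => a - w) (by fun_prop) hdK ha hdα hMβ hw hw'
    have hs := D.notMem_singular hw'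
    have hs' := D.notMem_singular (z := -w) (by rwa [neg_neg])
    have hWr := latticeWronskian_eq_two_mul (D.jost.solves_lam hs') (D.jost.solves_lam hs) Γ
      (D.jost.tendsto_lam hs') (D.jost.tendsto_lam hs) n r
    unfold latticeWronskian at hWr
    have h3 : 2 * w * d w = 0 := by
      linear_combination (-d w) * hWr
        - (S.p r + w) * Lam (n + Pi.single r 1) w * h1 + Lam n w * h2
    exact (mul_eq_zero.1 h3).resolve_left (mul_ne_zero two_ne_zero hw0)
  have hWpre : IsPreconnected W := by
    have h : W = (fun z => -z) '' L.outside := by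
      ext z
      simp [hWdef]
    rw [h]
    exact ClosedContour.isPreconnected_outside.image _ continuous_neg.continuousOn
  obtain ⟨z₀, ⟨hz₀, hz₀'⟩, hz₀0⟩ := ((ClosedContour.eventually_mem_outside.and hfar).and hne).exists
  have hev : d =ᶠ[𝓝 z₀] 0 := by
    filter_upwards [ClosedContour.isOpen_outside.mem_nhds hz₀, hW.mem_nhds hz₀',
      isOpen_ne.mem_nhds hz₀0] with u h1 h2 h3
    exact hzero u h1 h2 h3
  intro ζ hζ
  exact sub_eq_zero.1 ((hdd.analyticOnNhd hW).eqOn_zero_of_preconnected_of_eventuallyEq_zero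
    hWpre hz₀' hev hζ)

end ScatteringData

end Q3Solution

theorem proposition2p3 {N : ℕ} (S : Q3Solution N) (Γ : Staircase N) (K : ℝ)
    (hp : ∀ i, S.p (Γ.dir i) ≠ 0)
    (hK : S.WeightBound Γ K)
    (L : ClosedContour) (hL : L.PositivelyOriented)
    (hLP : L.trace ⊆ (closure (S.regionP Γ K))ᶜ)
    (hPstar : S.regionPStar Γ K ⊆ L.inside)
    (h0 : (0 : ℂ) ∈ L.outside)
    (hab : ∀ z ∈ ({S.a, -S.a, S.b, -S.b} : Set ℂ), z ∈ L.outside)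
    -- the contour and its interior do not meet their reflection in the origin
    (hrefl : ∀ z ∈ L.inside ∪ L.trace, -z ∈ L.outside)
    -- the singularities of the plane-wave factors do not lie on the contour
    (hpL : ∀ r, S.p r ∉ L.trace ∧ -S.p r ∉ L.trace)
    (Lam Ups : (Fin N → ℤ) → ℂ → ℂ)
    (hJost : S.IsJost Γ K {ζ | ∃ r, S.p r ∈ L.inside ∧ ζ = -S.p r} Lam Ups)
    (hadm : S.Admissible Γ Lam Ups K)
    (hzeros : S.zerosA Γ Lam Ups K ⊆ L.inside)
    -- the plane-wave factors are defined at the zeros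
    (hpz : ∀ z ∈ S.zerosA Γ Lam Ups K, ∀ r, z ≠ S.p r ∧ z ≠ -S.p r) :
    ∃ c : ℂ → ℂ,
      (∀ z ∈ S.zerosA Γ Lam Ups K, z ∈ S.regionPStar Γ K →
        ∀ i, Ups (Γ.pt i) z = c z * planeWave S.p (Γ.pt i) z * Lam (Γ.pt i) z) ∧
      ∀ n : Fin N → ℤ,
        S.SolvesIntegralEq Γ Lam Ups K L c n (Lam n) ∧
        ∀ f : ℂ → ℂ, S.SolvesIntegralEq Γ Lam Ups K L c n f →
          EqOn f (Lam n) {ζ | -ζ ∈ L.outside} := by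
  have D : S.ScatteringData Γ K L Lam Ups :=
    { p_ne := hp
      one_lt := Q3Solution.one_lt_of_weightBound hK
      oriented := hL
      pStar_subset := hPstar
      zero_mem := h0
      refl := hrefl
      p_notMem := hpL
      jost := hJost
      adm := hadm
      zeros_subset := hzeros
      zeros_ne := hpz }
  have hex : ∀ z, ∃ c : ℂ, z ∈ S.zerosA Γ Lam Ups K →
      ∀ n, Ups n z = c * planeWave S.p n z * Lam n z := by
    intro z
    by_cases hz : z ∈ S.zerosA Γ Lam Ups K
    · obtain ⟨c, hc⟩ := D.jost.exists_ups_eq hz.1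
        (D.notMem_singular (D.refl z (Or.inl (D.zeros_subset hz))))
        (fun r h => (hpz z hz r).2 (eq_neg_of_add_eq_zero_right h))
        (fun r h => (hpz z hz r).1 (sub_eq_zero.1 h).symm) hz.2.2
      exact ⟨c, fun _ => hc⟩
    · exact ⟨0, fun h => absurd h hz⟩
  choose c hc using hex
  refine ⟨c, fun z hz _ i => hc z hz (Γ.pt i), fun n => ⟨?_, fun f hf => ?_⟩⟩
  · refine (Q3Solution.solvesIntegralEq_iff hadm.finite_zeros).2
      ⟨ClosedContour.integrable_of_continuousOn ((D.continuousOn_density n).mul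
        ((D.differentiableOn_lam n).continuousOn.mono fun z hz => hrefl z (Or.inr hz))),
        fun w hw => D.lam_eq hc n hw⟩
  · obtain ⟨h1, h2⟩ := (Q3Solution.solvesIntegralEq_iff hadm.finite_zeros).1 hf
    exact D.eq_lam_of_eq hc n h1 h2
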